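/- For $x>0$ let $$\Gamma_q(x)=(1-q)^{1-x}\prod_{n=0}^\infty\frac{1-q^{n+1}}{1-q^{n+x}}\quad(0<q<1),\qquad \Gamma_q(x)=(q-1)^{1-x}q^{x(x-1)/2}\prod_{n=0}^\infty\frac{1-q^{-(n+1)}}{1-q^{-(n+x)}}\quad(q>1),$$ let $\Gamma_1=\Gamma$ be Euler's gamma function, and for $q>0$ let $\psi_q=\Gamma_q'/\Gamma_q$, with derivatives taken in $x$. Let $$q_0=\frac1{3\sqrt[3]2}\left(2\sqrt[3]2+\sqrt[3]{25-3\sqrt{69}}+\sqrt[3]{25+3\sqrt{69}}\right)\simeq 1.75488$$ (that is, $q_0>0$ and $|q_0-1.75488|<5\cdot10^{-6}$). Then $q_0$ is the unique positive solution of $(\sqrt q)^3-\sqrt q-1=0$. Moreover, for every $q>0$ the function $\psi_q$ has exactly one zero $x_q$ in $(0,\infty)$, it satisfies $1<x_q<\frac32$, and, with $$G_q(x)=\frac{\psi_q'(x)}{\psi_q(x)},\qquad \varphi_q(x)=x\,\frac{\psi_q'(x)}{\psi_q(x)}\qquad(x>0,\ x\ne x_q),$$ the following hold. Both functions have a pole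 at $x_q$; "decreasing on $(1,\infty)$" means decreasing on each of the intervals $(1,x_q)$ and $(x_q,\infty)$. 1. If $q\ge1$, then $G_q$ is strictly decreasing on $(1,\infty)$. 2. If $q>1$, then $\varphi_q$ is strictly decreasing on $(1,x_q)$. For $q>0$, $\varphi_q$ is decreasing on $(1,\infty)$ if and only if $q\in(0,1]\cup[q_0,\infty)$; this equivalence holds both with "decreasing" in the strict sense and with "decreasing" in the weak (non-increasing) sense. -/

import Mathlib

open Set

noncomputable section

/-- The `q`-gamma function `Γ_q(x)` for `q > 0` and `x > 0`; for `q = 1` it is Euler's `Γ`,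
the common limit of the other two branches as `q → 1`. -/
def qGamma (q x : ℝ) : ℝ :=
  if q < 1 then
    (1 - q) ^ (1 - x) * ∏' n : ℕ, (1 - q ^ ((n : ℝ) + 1)) / (1 - q ^ ((n : ℝ) + x))
  else if q = 1 then
    Real.Gamma x
  else
    (q - 1) ^ (1 - x) * q ^ (x * (x - 1) / 2) *
      ∏' n : ℕ, (1 - q ^ (-((n : ℝ) + 1))) / (1 - q ^ (-((n : ℝ) + x)))

/-- The `q`-digamma function `ψ_q = Γ_q' / Γ_q`. -/
def qDigamma (q x : ℝ) : ℝ := deriv (qGamma q) x / qGamma q x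

/-- `G_q(x) = ψ_q'(x) / ψ_q(x)`. -/
def qDigammaRatio (q x : ℝ) : ℝ := deriv (qDigamma q) x / qDigamma q x

/-- `φ_q(x) = x ψ_q'(x) / ψ_q(x)`. -/
def qDigammaElasticity (q x : ℝ) : ℝ := x * (deriv (qDigamma q) x / qDigamma q x)

/-- `q₀ = (2 ∛2 + ∛(25 - 3 √69) + ∛(25 + 3 √69)) / (3 ∛2)`; both radicands are positive. -/
def criticalBase : ℝ :=
  1 / (3 * (2 : ℝ) ^ (1 / 3 : ℝ)) *
    (2 * (2 : ℝ) ^ (1 / 3 : ℝ) + (25 - 3 * √69) ^ (1 / 3 : ℝ) + (25 + 3 * √69) ^ (1 / 3 : ℝ))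

end

/-!
Write `h = |log q|`, `p = exp (-h)`, `y = exp (-h x)` and `S_j = ∑_{k ≥ 1} k ^ j y ^ k / (1 - p ^ k)`.
Expanding the logarithms in the product for `Γ_q` gives
`ψ_q = -log (1 - q) - h S₀` for `q < 1` and `ψ_q = h (x - 1/2) - log (q - 1) - h S₀` for `q > 1`, and
in both cases `S_j' = -h S_{j+1}`. For `q = 1`, Euler's limit formula gives
`ψ' = ∑ 1 / (x + n)²`. These are the three instances of `LogGammaModel`.

*The zero.* `ψ_q` is increasing and concave, and its integral over `[1, 2]` is
`log Γ_q(2) - log Γ_q(1) = 0`. Hence `ψ_q(1) < 0 < ψ_q(3/2)`.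

*Left of the zero.* Concavity and `x_q < 3/2` give `-ψ_q(x) < (3/2 - x) ψ_q'(x)`. So `G_q` decreases
as soon as `-ψ_q'' ≤ 2 ψ_q'`, and `φ_q` decreases as soon as `-ψ_q'' ≤ 3 ψ_q'`. The first holds for
`q ≥ 1` and the second for `exp (-2) ≤ q < 1`. For `q ≠ 1` both rest on `lambertSeries_two_le`,
which bounds `S₂ / S₁` by the quotient of `∑ k² y ^ k` by `∑ k y ^ k`. For `q ≤ exp (-2)` the first term of
each series dominates, and `ψ_q'' ψ_q < ψ_q' ^ 2` follows from
`lambertSeries_zero_mul_two_sub_le`.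

*Right of the zero.* `G_q` is a positive decreasing function over a positive increasing one. For
`q ≤ 1` the product `x ψ_q'` is non-increasing on `[1, ∞)` (`lambertSeries_one_le`,
`tsum_sq_le_mul_tsum_cube`), so `φ_q` decreases. For `q > 1`, `ψ_q(x) = h (x + a) - h S₀` with
`h a = -(log q / 2 + log (q - 1))`, and `a ≤ 0` exactly when `q (q - 1)² ≥ 1`, that is, `q ≥ q₀`. If
`a ≤ 0`, then `ψ_q < h x < x ψ_q'`, which forces `φ_q` to decrease. If `a > 0`, then `φ_q` tends to
`1` at infinity from below, so it cannot be non-increasing.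
-/

section

open Real

/-! ### Consequences of the sign and concavity properties of `log Γ_q` -/

/-- A model of `log Γ_q` and its first three derivatives on `(0, ∞)`: `F = log Γ_q`, `f = ψ_q`,
`f₁ = ψ_q'`, `f₂ = ψ_q''`, together with the sign conditions `ψ_q' > 0`, `ψ_q'' < 0` and the
normalisation `Γ_q(1) = Γ_q(2)`. -/
structure LogGammaModel (q : ℝ) (F f f₁ f₂ : ℝ → ℝ) : Prop where
  qGamma_eq : ∀ x, 0 < x → qGamma q x = Real.exp (F x)
  hasDerivAt_log : ∀ x, 0 < x → HasDerivAt F (f x) x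
  hasDerivAt_psi : ∀ x, 0 < x → HasDerivAt f (f₁ x) x
  hasDerivAt_psi' : ∀ x, 0 < x → HasDerivAt f₁ (f₂ x) x
  psi'_pos : ∀ x, 0 < x → 0 < f₁ x
  psi''_neg : ∀ x, 0 < x → f₂ x < 0
  one_eq_two : F 1 = F 2

namespace LogGammaModel

variable {q : ℝ} {F f f₁ f₂ : ℝ → ℝ}

theorem qDigamma_eq (M : LogGammaModel q F f f₁ f₂) {x : ℝ} (hx : 0 < x) :
    qDigamma q x = f x := by
  have h : qGamma q =ᶠ[nhds x] fun x => Real.exp (F x) := by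
    filter_upwards [Ioi_mem_nhds hx] with y hy using M.qGamma_eq y hy
  rw [qDigamma, h.deriv_eq, (M.hasDerivAt_log x hx).exp.deriv, M.qGamma_eq x hx]
  field_simp

theorem deriv_qDigamma_eq (M : LogGammaModel q F f f₁ f₂) {x : ℝ} (hx : 0 < x) :
    deriv (qDigamma q) x = f₁ x := by
  have h : qDigamma q =ᶠ[nhds x] f := by
    filter_upwards [Ioi_mem_nhds hx] with y hy using M.qDigamma_eq hy
  rw [h.deriv_eq, (M.hasDerivAt_psi x hx).deriv]

theorem qDigammaRatio_eq (M : LogGammaModel q F f f₁ f₂) {x : ℝ} (hx : 0 < x) :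
    qDigammaRatio q x = f₁ x / f x := by
  rw [qDigammaRatio, M.deriv_qDigamma_eq hx, M.qDigamma_eq hx]

theorem qDigammaElasticity_eq (M : LogGammaModel q F f f₁ f₂) {x : ℝ} (hx : 0 < x) :
    qDigammaElasticity q x = x * f₁ x / f x := by
  rw [qDigammaElasticity, M.deriv_qDigamma_eq hx, M.qDigamma_eq hx, mul_div_assoc]

theorem strictMonoOn_psi (M : LogGammaModel q F f f₁ f₂) : StrictMonoOn f (Ioi 0) := by
  refine strictMonoOn_of_deriv_pos (convex_Ioi 0)
    (fun x hx => (M.hasDerivAt_psi x hx).continuousAt.continuousWithinAt) fun x hx => ?_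
  rw [interior_Ioi] at hx
  rw [(M.hasDerivAt_psi x hx).deriv]
  exact M.psi'_pos x hx

theorem strictAntiOn_psi' (M : LogGammaModel q F f f₁ f₂) : StrictAntiOn f₁ (Ioi 0) := by
  refine strictAntiOn_of_deriv_neg (convex_Ioi 0)
    (fun x hx => (M.hasDerivAt_psi' x hx).continuousAt.continuousWithinAt) fun x hx => ?_
  rw [interior_Ioi] at hx
  rw [(M.hasDerivAt_psi' x hx).deriv]
  exact M.psi''_neg x hx

theorem exists_psi_sub_eq (M : LogGammaModel q F f f₁ f₂) {a b : ℝ} (ha : 0 < a) (hab : a < b) :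
    ∃ c ∈ Ioo a b, f b - f a = f₁ c * (b - a) := by
  obtain ⟨c, hc, e⟩ := exists_hasDerivAt_eq_slope f f₁ hab
    (fun x hx => (M.hasDerivAt_psi x (ha.trans_le hx.1)).continuousAt.continuousWithinAt)
    (fun x hx => M.hasDerivAt_psi x (ha.trans hx.1))
  refine ⟨c, hc, ?_⟩
  rw [e, div_mul_cancel₀ _ (sub_pos.2 hab).ne']

theorem psi_one_neg (M : LogGammaModel q F f f₁ f₂) : f 1 < 0 := by
  obtain ⟨c, hc, e⟩ := exists_hasDerivAt_eq_slope F f (one_lt_two (α := ℝ))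
    (fun x hx => (M.hasDerivAt_log x (one_pos.trans_le hx.1)).continuousAt.continuousWithinAt)
    (fun x hx => M.hasDerivAt_log x (one_pos.trans hx.1))
  rw [M.one_eq_two, sub_self, zero_div] at e
  rw [← e]
  exact M.strictMonoOn_psi (mem_Ioi.2 one_pos) (mem_Ioi.2 (one_pos.trans hc.1)) hc.1

/-- By strict concavity, the value of `ψ_q` at the midpoint of `[1, 2]` exceeds its mean over
`[1, 2]`, and that mean is `log Γ_q(2) - log Γ_q(1) = 0`. -/
theorem psi_three_halves_pos (M : LogGammaModel q F f f₁ f₂) : 0 < f (3 / 2) := by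
  obtain ⟨t, ht, e⟩ := exists_hasDerivAt_eq_slope (fun t => F (3 / 2 + t) - F (3 / 2 - t))
    (fun t => f (3 / 2 + t) + f (3 / 2 - t)) (show (0 : ℝ) < 1 / 2 by norm_num)
    (by
      refine fun t ht => ContinuousAt.continuousWithinAt ?_
      have h1 := (M.hasDerivAt_log (3 / 2 + t) (by linarith [ht.1])).comp_const_add _ _
      have h2 := (M.hasDerivAt_log (3 / 2 - t) (by linarith [ht.2])).comp_const_sub _ _
      exact (h1.sub h2).continuousAt)
    (by
      intro t ht
      have h1 := (M.hasDerivAt_log (3 / 2 + t) (by linarith [ht.1])).comp_const_add _ _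
      have h2 := (M.hasDerivAt_log (3 / 2 - t) (by linarith [ht.2])).comp_const_sub _ _
      simpa using h1.fun_sub h2)
  have e' : f (3 / 2 + t) + f (3 / 2 - t) = 0 := by
    rw [e]
    norm_num [M.one_eq_two]
  obtain ⟨a, ha, ea⟩ := M.exists_psi_sub_eq (a := 3 / 2 - t) (b := 3 / 2)
    (by linarith [ht.2]) (by linarith [ht.1])
  obtain ⟨b, hb, eb⟩ := M.exists_psi_sub_eq (a := 3 / 2) (b := 3 / 2 + t)
    (by norm_num) (by linarith [ht.1])
  have hlt : f₁ b < f₁ a := M.strictAntiOn_psi' (mem_Ioi.2 (by linarith [ha.1, ht.2]))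
    (mem_Ioi.2 (by linarith [hb.1])) (ha.2.trans hb.1)
  nlinarith [ht.1]

theorem exists_zero (M : LogGammaModel q F f f₁ f₂) : ∃ z, 1 < z ∧ z < 3 / 2 ∧ f z = 0 := by
  obtain ⟨z, hz, e⟩ := intermediate_value_Ioo (show (1 : ℝ) ≤ 3 / 2 by norm_num) (f := f)
    (fun x hx => (M.hasDerivAt_psi x (one_pos.trans_le hx.1)).continuousAt.continuousWithinAt)
    ⟨M.psi_one_neg, M.psi_three_halves_pos⟩
  exact ⟨z, hz.1, hz.2, e⟩

theorem qDigamma_eq_zero_iff (M : LogGammaModel q F f f₁ f₂) {z : ℝ} (hz : 0 < z) (h0 : f z = 0)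
    {x : ℝ} (hx : 0 < x) : qDigamma q x = 0 ↔ x = z := by
  rw [M.qDigamma_eq hx, ← h0]
  exact M.strictMonoOn_psi.injOn.eq_iff hx hz

theorem psi_pos (M : LogGammaModel q F f f₁ f₂) {z x : ℝ} (hz : 0 < z) (h0 : f z = 0)
    (hx : z < x) : 0 < f x := by
  rw [← h0]
  exact M.strictMonoOn_psi hz (mem_Ioi.2 (hz.trans hx)) hx

theorem psi_neg (M : LogGammaModel q F f f₁ f₂) {z x : ℝ} (h0 : f z = 0)
    (hx0 : 0 < x) (hx : x < z) : f x < 0 := by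
  rw [← h0]
  exact M.strictMonoOn_psi hx0 (mem_Ioi.2 (hx0.trans hx)) hx

/-- The tangent bound `-ψ_q(x) < (3/2 - x) ψ_q'(x)` to the left of the zero, from concavity and
from the zero lying below `3/2`. -/
theorem neg_psi_lt (M : LogGammaModel q F f f₁ f₂) {z x : ℝ} (h0 : f z = 0) (hz : z < 3 / 2)
    (hx0 : 0 < x) (hx : x < z) : -f x < (3 / 2 - x) * f₁ x := by
  obtain ⟨c, hc, e⟩ := M.exists_psi_sub_eq hx0 hx
  have h1 : f₁ c < f₁ x := M.strictAntiOn_psi' hx0 (mem_Ioi.2 (hx0.trans hc.1)) hc.1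
  have h2 := M.psi'_pos x hx0
  rw [h0, zero_sub] at e
  rw [e]
  nlinarith

theorem strictAntiOn_ratio_right (M : LogGammaModel q F f f₁ f₂) {z : ℝ} (hz : 0 < z)
    (h0 : f z = 0) : StrictAntiOn (qDigammaRatio q) (Ioi z) := by
  intro x hx y hy hxy
  have hx' : 0 < x := hz.trans hx
  have hy' : 0 < y := hz.trans hy
  rw [M.qDigammaRatio_eq hx', M.qDigammaRatio_eq hy']
  exact div_lt_div₀ (M.strictAntiOn_psi' hx' hy' hxy) (M.strictMonoOn_psi hx' hy' hxy).le
    (M.psi'_pos x hx').le (M.psi_pos hz h0 hx)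

theorem strictAntiOn_ratio_left (M : LogGammaModel q F f f₁ f₂) {z : ℝ} (h0 : f z = 0)
    (h : ∀ x, 1 < x → x < z → f₂ x * f x < f₁ x ^ 2) :
    StrictAntiOn (qDigammaRatio q) (Ioo 1 z) := by
  have hd : ∀ x ∈ Ioo 1 z, HasDerivAt (fun x => f₁ x / f x)
      ((f₂ x * f x - f₁ x * f₁ x) / f x ^ 2) x := fun x hx =>
    (M.hasDerivAt_psi' x (one_pos.trans hx.1)).fun_div (M.hasDerivAt_psi x (one_pos.trans hx.1))
      (M.psi_neg h0 (one_pos.trans hx.1) hx.2).ne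
  refine StrictAntiOn.congr (f₁ := fun x => f₁ x / f x) ?_
    fun x hx => (M.qDigammaRatio_eq (one_pos.trans hx.1)).symm
  refine strictAntiOn_of_deriv_neg (convex_Ioo 1 z)
    (fun x hx => (hd x hx).continuousAt.continuousWithinAt) fun x hx => ?_
  rw [interior_Ioo] at hx
  rw [(hd x hx).deriv]
  have h1 := M.psi_neg h0 (one_pos.trans hx.1) hx.2
  exact div_neg_of_neg_of_pos (by nlinarith [h x hx.1 hx.2]) (sq_pos_of_neg h1)

/-- From `neg_psi_lt` and `3/2 - x < 1/2`. -/
theorem mul_lt_sq_of_neg_psi''_le (M : LogGammaModel q F f f₁ f₂) {z x : ℝ} (h0 : f z = 0)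
    (hz : z < 3 / 2) (hx1 : 1 < x) (hx : x < z) (h : -f₂ x ≤ 2 * f₁ x) :
    f₂ x * f x < f₁ x ^ 2 := by
  have hx0 : 0 < x := one_pos.trans hx1
  have h1 := M.neg_psi_lt h0 hz hx0 hx
  have h2 := M.psi'_pos x hx0
  have h3 := M.psi''_neg x hx0
  have h4 : -f x < 1 / 2 * f₁ x := by nlinarith
  nlinarith

theorem strictAntiOn_elasticity_left_of_ratio (M : LogGammaModel q F f f₁ f₂) {z : ℝ}
    (h0 : f z = 0) (h : StrictAntiOn (qDigammaRatio q) (Ioo 1 z)) :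
    StrictAntiOn (qDigammaElasticity q) (Ioo 1 z) := by
  intro x hx y hy hxy
  have hx' : 0 < x := one_pos.trans hx.1
  have h1 := h hx hy hxy
  have h2 : qDigammaRatio q x < 0 := by
    rw [M.qDigammaRatio_eq hx']
    exact div_neg_of_pos_of_neg (M.psi'_pos x hx') (M.psi_neg h0 hx' hx.2)
  change y * qDigammaRatio q y < x * qDigammaRatio q x
  nlinarith

theorem hasDerivAt_elasticity (M : LogGammaModel q F f f₁ f₂) {x : ℝ} (hx : 0 < x)
    (hf : f x ≠ 0) : HasDerivAt (fun x => x * f₁ x / f x)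
      (((f₁ x + x * f₂ x) * f x - x * f₁ x * f₁ x) / f x ^ 2) x := by
  have h1 : HasDerivAt (fun x => x * f₁ x) (f₁ x + x * f₂ x) x := by
    simpa using (hasDerivAt_id x).fun_mul (M.hasDerivAt_psi' x hx)
  exact h1.fun_div (M.hasDerivAt_psi x hx) hf

/-- If `x |ψ_q''| ≤ ψ_q'` the derivative of `φ_q` is visibly negative; otherwise `-ψ_q` is bounded by
`neg_psi_lt`. Both cases are treated at once, using `x |ψ_q''| - ψ_q' ≤ (3 x - 1) ψ_q'`. -/
theorem strictAntiOn_elasticity_left (M : LogGammaModel q F f f₁ f₂) {z : ℝ} (h0 : f z = 0)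
    (hz : z < 3 / 2) (h : ∀ x, 1 < x → -f₂ x ≤ 3 * f₁ x) :
    StrictAntiOn (qDigammaElasticity q) (Ioo 1 z) := by
  have hd : ∀ x ∈ Ioo 1 z, HasDerivAt (fun x => x * f₁ x / f x)
      (((f₁ x + x * f₂ x) * f x - x * f₁ x * f₁ x) / f x ^ 2) x := fun x hx =>
    M.hasDerivAt_elasticity (one_pos.trans hx.1) (M.psi_neg h0 (one_pos.trans hx.1) hx.2).ne
  refine StrictAntiOn.congr (f₁ := fun x => x * f₁ x / f x) ?_
    fun x hx => (M.qDigammaElasticity_eq (one_pos.trans hx.1)).symm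
  refine strictAntiOn_of_deriv_neg (convex_Ioo 1 z)
    (fun x hx => (hd x hx).continuousAt.continuousWithinAt) fun x hx => ?_
  rw [interior_Ioo] at hx
  rw [(hd x hx).deriv]
  have hx0 : 0 < x := one_pos.trans hx.1
  have h1 := M.psi_neg h0 hx0 hx.2
  have h2 := M.psi'_pos x hx0
  have h3 := M.neg_psi_lt h0 hz hx0 hx.2
  refine div_neg_of_neg_of_pos ?_ (sq_pos_of_neg h1)
  have h4 := h x hx.1
  have h5 : -(f₁ x + x * f₂ x) ≤ (3 * x - 1) * f₁ x := by nlinarith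
  have h6 : 0 < (3 * x - 1) * f₁ x := mul_pos (by linarith [hx.1]) h2
  have h7 : -(f₁ x + x * f₂ x) * (-f x) ≤ (3 * x - 1) * f₁ x * -f x :=
    mul_le_mul_of_nonneg_right h5 (by linarith)
  have h8 : (3 * x - 1) * f₁ x * -f x < (3 * x - 1) * f₁ x * ((3 / 2 - x) * f₁ x) :=
    mul_lt_mul_of_pos_left h3 h6
  -- `(3x - 1)(3/2 - x) ≤ x` is `(2x - 1)(x - 1) ≥ 0`
  have h9 : (3 * x - 1) * (3 / 2 - x) ≤ x := by nlinarith [hx.1]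
  have h10 := mul_le_mul_of_nonneg_right h9 (sq_nonneg (f₁ x))
  nlinarith

theorem strictAntiOn_elasticity_right (M : LogGammaModel q F f f₁ f₂) {z : ℝ} (hz : 0 < z)
    (h0 : f z = 0) (h : ∀ x, z < x → (f₁ x + x * f₂ x) * f x < x * f₁ x ^ 2) :
    StrictAntiOn (qDigammaElasticity q) (Ioi z) := by
  have hd : ∀ x ∈ Ioi z, HasDerivAt (fun x => x * f₁ x / f x)
      (((f₁ x + x * f₂ x) * f x - x * f₁ x * f₁ x) / f x ^ 2) x := fun x hx =>
    M.hasDerivAt_elasticity (hz.trans hx) (M.psi_pos hz h0 hx).ne'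
  refine StrictAntiOn.congr (f₁ := fun x => x * f₁ x / f x) ?_
    fun x hx => (M.qDigammaElasticity_eq (hz.trans hx)).symm
  refine strictAntiOn_of_deriv_neg (convex_Ioi z)
    (fun x hx => (hd x hx).continuousAt.continuousWithinAt) fun x hx => ?_
  rw [interior_Ioi] at hx
  rw [(hd x hx).deriv]
  have h1 := M.psi_pos hz h0 hx
  exact div_neg_of_neg_of_pos (by nlinarith [h x hx]) (by positivity)

end LogGammaModel

/-! ### Lambert series -/

theorem summable_mul_pow_of_le_pow {a : ℕ → ℝ} {C : ℝ} {r : ℕ} (ha : ∀ k, |a k| ≤ C * (k : ℝ) ^ r)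
    {y : ℝ} (hy0 : 0 ≤ y) (hy1 : y < 1) : Summable fun k => a k * y ^ k := by
  have h1 : ‖y‖ < 1 := by rwa [Real.norm_of_nonneg hy0]
  refine Summable.of_norm_bounded
    ((summable_pow_mul_geometric_of_norm_lt_one r h1).mul_left C) fun k => ?_
  rw [norm_mul, Real.norm_eq_abs, Real.norm_of_nonneg (pow_nonneg hy0 k), ← mul_assoc]
  exact mul_le_mul_of_nonneg_right (ha k) (pow_nonneg hy0 k)

theorem exp_neg_mul_lt_one {h x : ℝ} (hh : 0 < h) (hx : 0 < x) : exp (-(h * x)) < 1 :=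
  Real.exp_lt_one_iff.2 (neg_neg_of_pos (mul_pos hh hx))

/-- Termwise differentiation of a power series in `exp (-h x)` whose coefficients grow at most
polynomially. -/
theorem hasDerivAt_tsum_mul_exp_pow {a : ℕ → ℝ} {C : ℝ} {r : ℕ}
    (ha : ∀ k, |a k| ≤ C * (k : ℝ) ^ r) {h x : ℝ} (hh : 0 < h) (hx : 0 < x) :
    HasDerivAt (fun x => ∑' k, a k * exp (-(h * x)) ^ k)
      (-h * ∑' k : ℕ, k * a k * exp (-(h * x)) ^ k) x := by
  have hx2 : 0 < x / 2 := half_pos hx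
  have hy1 := exp_neg_mul_lt_one hh hx2
  have hb : ∀ k : ℕ, |(k : ℝ) * a k| ≤ C * (k : ℝ) ^ (r + 1) := fun k => by
    rw [abs_mul, Nat.abs_cast, pow_succ]
    nlinarith [ha k, (k.cast_nonneg : (0 : ℝ) ≤ k)]
  have hu : Summable fun k : ℕ => h * (|(k : ℝ) * a k| * exp (-(h * (x / 2))) ^ k) :=
    (summable_mul_pow_of_le_pow (a := fun k => |(k : ℝ) * a k|) (C := C) (r := r + 1)
      (fun k => by rw [abs_abs]; exact hb k) (exp_pos _).le hy1).mul_left h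
  rw [← tsum_mul_left]
  refine hasDerivAt_tsum_of_isPreconnected (t := Ioi (x / 2)) (y₀ := x)
    (g := fun k x => a k * exp (-(h * x)) ^ k)
    (g' := fun k x => -h * (k * a k * exp (-(h * x)) ^ k)) hu isOpen_Ioi
    isPreconnected_Ioi (fun k y _ => ?_) (fun k y hy => ?_) (mem_Ioi.2 (half_lt_self hx))
    (summable_mul_pow_of_le_pow ha (exp_pos _).le (exp_neg_mul_lt_one hh hx))
    (mem_Ioi.2 (half_lt_self hx))
  · have h1 : HasDerivAt (fun y : ℝ => exp (-(h * y) * k)) (exp (-(h * y) * k) * (-h * k)) y := by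
      have := ((((hasDerivAt_id y).const_mul h).fun_neg).mul_const (k : ℝ)).exp
      simpa using this
    have h2 : ∀ y : ℝ, exp (-(h * y)) ^ k = exp (-(h * y) * k) := fun y => by
      rw [← Real.exp_nat_mul, mul_comm]
    simp_rw [h2]
    convert! h1.const_mul (a k) using 1
    ring
  · have hy' : x / 2 < y := hy
    rw [norm_mul, norm_neg, Real.norm_of_nonneg hh.le, norm_mul, Real.norm_eq_abs,
      Real.norm_of_nonneg (pow_nonneg (exp_pos _).le k)]
    gcongr

/-- The weight `1 / (1 - q ^ s)` for `q = exp (-h)`. At `s = 0` it is `1 / 0 = 0`, so that series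
over all of `ℕ` with these weights carry no constant term. -/
noncomputable def lambertWeight (h s : ℝ) : ℝ := 1 / (1 - exp (-(h * s)))

/-- The Lambert series `∑_{k ≥ 1} k ^ j q ^ (k x) / (1 - q ^ k)` for `q = exp (-h)`. -/
noncomputable def lambertSeries (h : ℝ) (j : ℕ) (x : ℝ) : ℝ :=
  ∑' k : ℕ, (k : ℝ) ^ j * lambertWeight h k * exp (-(h * x)) ^ k

/-- The Lambert series `∑_{k ≥ 1} q ^ (k x) / (k (1 - q ^ k))` for `q = exp (-h)`. -/
noncomputable def lambertLog (h x : ℝ) : ℝ :=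
  ∑' k : ℕ, (k : ℝ)⁻¹ * lambertWeight h k * exp (-(h * x)) ^ k

theorem lambertWeight_zero (h : ℝ) : lambertWeight h 0 = 0 := by simp [lambertWeight]

theorem lambertWeight_pos {h s : ℝ} (hh : 0 < h) (hs : 0 < s) : 0 < lambertWeight h s :=
  one_div_pos.2 (sub_pos.2 (exp_neg_mul_lt_one hh hs))

theorem lambertWeight_anti {h s t : ℝ} (hh : 0 < h) (hs : 0 < s) (hst : s ≤ t) :
    lambertWeight h t ≤ lambertWeight h s := by
  refine one_div_le_one_div_of_le (sub_pos.2 (exp_neg_mul_lt_one hh hs)) ?_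
  have : exp (-(h * t)) ≤ exp (-(h * s)) := exp_le_exp.2 (by nlinarith)
  linarith

theorem lambertWeight_nat_nonneg {h : ℝ} (hh : 0 < h) (k : ℕ) : 0 ≤ lambertWeight h k := by
  rcases k.eq_zero_or_pos with rfl | hk
  · simp [lambertWeight_zero]
  · exact (lambertWeight_pos hh (by exact_mod_cast hk)).le

theorem lambertWeight_nat_le {h : ℝ} (hh : 0 < h) (k : ℕ) :
    lambertWeight h k ≤ lambertWeight h 1 := by
  rcases k.eq_zero_or_pos with rfl | hk
  · simpa [lambertWeight_zero] using (lambertWeight_pos hh one_pos).le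
  · exact lambertWeight_anti hh one_pos (by exact_mod_cast hk)

/-- `s / (1 - q ^ s)` increases with `s`: `1 - q ^ s` is concave and vanishes at `s = 0`. -/
theorem mul_lambertWeight_mono {h s t : ℝ} (hh : 0 < h) (hs : 0 < s) (hst : s ≤ t) :
    s * lambertWeight h s ≤ t * lambertWeight h t := by
  have ht : 0 < t := hs.trans_le hst
  have h1 : 0 < 1 - exp (-(h * s)) := sub_pos.2 (exp_neg_mul_lt_one hh hs)
  have h2 : 0 < 1 - exp (-(h * t)) := sub_pos.2 (exp_neg_mul_lt_one hh ht)
  have h3 := convexOn_exp.2 (mem_univ (-(h * t))) (mem_univ 0) (div_nonneg hs.le ht.le)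
    (sub_nonneg.2 ((div_le_one ht).2 hst)) (by ring)
  have h4 : (s / t) • (-(h * t)) + (1 - s / t) • (0 : ℝ) = -(h * s) := by
    simp only [smul_eq_mul]
    field_simp
    simp
  rw [h4, smul_eq_mul, smul_eq_mul, exp_zero] at h3
  rw [lambertWeight, lambertWeight, mul_one_div, mul_one_div, div_le_div_iff₀ h1 h2]
  have h5 : s / t * t = s := div_mul_cancel₀ _ ht.ne'
  nlinarith

theorem abs_pow_mul_lambertWeight_le {h : ℝ} (hh : 0 < h) (j k : ℕ) :
    |(k : ℝ) ^ j * lambertWeight h k| ≤ lambertWeight h 1 * (k : ℝ) ^ j := by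
  rw [abs_of_nonneg (mul_nonneg (by positivity) (lambertWeight_nat_nonneg hh k)), mul_comm]
  exact mul_le_mul_of_nonneg_right (lambertWeight_nat_le hh k) (by positivity)

theorem abs_inv_mul_lambertWeight_le {h : ℝ} (hh : 0 < h) (k : ℕ) :
    |(k : ℝ)⁻¹ * lambertWeight h k| ≤ lambertWeight h 1 * (k : ℝ) ^ 0 := by
  rw [abs_of_nonneg (mul_nonneg (by positivity) (lambertWeight_nat_nonneg hh k)), pow_zero,
    mul_one]
  exact (mul_le_of_le_one_left (lambertWeight_nat_nonneg hh k) (Nat.cast_inv_le_one k)).trans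
    (lambertWeight_nat_le hh k)

theorem summable_lambertSeries {h x : ℝ} (hh : 0 < h) (hx : 0 < x) (j : ℕ) :
    Summable fun k : ℕ => (k : ℝ) ^ j * lambertWeight h k * exp (-(h * x)) ^ k :=
  summable_mul_pow_of_le_pow (abs_pow_mul_lambertWeight_le hh j) (exp_pos _).le
    (exp_neg_mul_lt_one hh hx)

theorem hasSum_lambertSeries {h x : ℝ} (hh : 0 < h) (hx : 0 < x) (j : ℕ) :
    HasSum (fun k : ℕ => (k : ℝ) ^ j * lambertWeight h k * exp (-(h * x)) ^ k)
      (lambertSeries h j x) :=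
  (summable_lambertSeries hh hx j).hasSum

theorem hasDerivAt_lambertSeries {h x : ℝ} (hh : 0 < h) (hx : 0 < x) (j : ℕ) :
    HasDerivAt (lambertSeries h j) (-h * lambertSeries h (j + 1) x) x := by
  convert! hasDerivAt_tsum_mul_exp_pow (abs_pow_mul_lambertWeight_le hh j) hh hx using 3
  refine tsum_congr fun k => ?_
  rw [pow_succ]
  ring

theorem hasDerivAt_lambertLog {h x : ℝ} (hh : 0 < h) (hx : 0 < x) :
    HasDerivAt (lambertLog h) (-h * lambertSeries h 0 x) x := by
  convert! hasDerivAt_tsum_mul_exp_pow (abs_inv_mul_lambertWeight_le hh) hh hx using 3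
  refine tsum_congr fun k => ?_
  rcases k.eq_zero_or_pos with rfl | hk
  · simp [lambertWeight_zero]
  · have : (k : ℝ) ≠ 0 := by positivity
    field_simp

theorem lambertSeries_pos {h x : ℝ} (hh : 0 < h) (hx : 0 < x) (j : ℕ) :
    0 < lambertSeries h j x := by
  refine (summable_lambertSeries hh hx j).tsum_pos (fun k => ?_) 1 ?_
  · have := lambertWeight_nat_nonneg hh k
    positivity
  · have := lambertWeight_pos hh one_pos
    simp only [Nat.cast_one]
    positivity

theorem lambertSeries_zero_le_one {h x : ℝ} (hh : 0 < h) (hx : 0 < x) :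
    lambertSeries h 0 x ≤ lambertSeries h 1 x := by
  refine hasSum_le (fun k : ℕ => ?_) (hasSum_lambertSeries hh hx 0) (hasSum_lambertSeries hh hx 1)
  rcases k.eq_zero_or_pos with rfl | hk
  · simp [lambertWeight_zero]
  · have h1 : (1 : ℝ) ≤ k := by exact_mod_cast hk
    have h2 := lambertWeight_nat_nonneg hh k
    rw [pow_zero, pow_one]
    gcongr

theorem hasSum_nat_mul_pow {y : ℝ} (hy0 : 0 ≤ y) (hy1 : y < 1) :
    HasSum (fun k : ℕ => (k : ℝ) * y ^ k) (y / (1 - y) ^ 2) :=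
  hasSum_coe_mul_geometric_of_norm_lt_one (by rwa [Real.norm_of_nonneg hy0])

theorem hasSum_nat_sq_mul_pow {y : ℝ} (hy0 : 0 ≤ y) (hy1 : y < 1) :
    HasSum (fun k : ℕ => (k : ℝ) ^ 2 * y ^ k) (y * (1 + y) / (1 - y) ^ 3) := by
  have hy : ‖y‖ < 1 := by rwa [Real.norm_of_nonneg hy0]
  have h2 := (hasSum_choose_mul_geometric_of_norm_lt_one 2 hy).mul_left 2
  have h1 := (hasSum_nat_mul_pow hy0 hy1).mul_left 3
  have h0 := (hasSum_geometric_of_lt_one hy0 hy1).mul_left 2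
  have hne : 1 - y ≠ 0 := (sub_pos.2 hy1).ne'
  convert! (h2.sub h1).sub h0 using 1
  · ext k
    rw [Nat.cast_choose_two]
    push_cast
    ring
  · field_simp
    ring

/-- If `ρ ≥ (1 + y) / (1 - y)`, the ratio of the second to the first moment of the weights `y ^ k`,
then `S₂ ≤ ρ S₁`. A Chebyshev-type argument: the decreasing factor `1 / (1 - q ^ k)` may be
replaced by its value at `k = ρ`, where `ρ - k` changes sign. -/
theorem lambertSeries_two_le {h x ρ : ℝ} (hh : 0 < h) (hx : 0 < x)
    (hρ : 1 + exp (-(h * x)) ≤ ρ * (1 - exp (-(h * x)))) :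
    lambertSeries h 2 x ≤ ρ * lambertSeries h 1 x := by
  set y := exp (-(h * x)) with hy
  have hy0 : 0 < y := exp_pos _
  have hy1 : y < 1 := exp_neg_mul_lt_one hh hx
  have hρ0 : 0 < ρ := by
    by_contra hc
    nlinarith
  have hL := ((hasSum_lambertSeries hh hx 1).mul_left ρ).sub (hasSum_lambertSeries hh hx 2)
  have hR := (((hasSum_nat_mul_pow hy0.le hy1).mul_left ρ).sub
    (hasSum_nat_sq_mul_pow hy0.le hy1)).mul_left (lambertWeight h ρ)
  have hle := hasSum_le (fun k : ℕ => ?_) hR hL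
  · have h1 : 0 ≤ lambertWeight h ρ * (ρ * (y / (1 - y) ^ 2) - y * (1 + y) / (1 - y) ^ 3) := by
      refine mul_nonneg (lambertWeight_pos hh hρ0).le ?_
      have h2 : ρ * (y / (1 - y) ^ 2) - y * (1 + y) / (1 - y) ^ 3
          = y * (ρ * (1 - y) - (1 + y)) / (1 - y) ^ 3 := by
        have : 1 - y ≠ 0 := (sub_pos.2 hy1).ne'
        field_simp
      rw [h2]
      have : 0 < 1 - y := sub_pos.2 hy1
      exact div_nonneg (mul_nonneg hy0.le (by linarith)) (by positivity)
    linarith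
  · rcases k.eq_zero_or_pos with rfl | hk
    · simp
    · have hk' : (0 : ℝ) < k := by exact_mod_cast hk
      have h3 : 0 ≤ (ρ - k) * (lambertWeight h k - lambertWeight h ρ) := by
        rcases le_total (k : ℝ) ρ with hle | hle
        · exact mul_nonneg (sub_nonneg.2 hle) (sub_nonneg.2 (lambertWeight_anti hh hk' hle))
        · exact mul_nonneg_of_nonpos_of_nonpos (sub_nonpos.2 hle)
            (sub_nonpos.2 (lambertWeight_anti hh hρ0 hle))
      have h4 : 0 ≤ k * y ^ k * ((ρ - k) * (lambertWeight h k - lambertWeight h ρ)) :=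
        mul_nonneg (by positivity) h3
      rw [← hy]
      nlinarith

/-- `S₁ ≤ h x S₂`, that is, `x ψ_q'(x)` is non-increasing for `q < 1`: the increasing factor
`k / (1 - q ^ k)` may be replaced by its value at `k = 1 / (h x)`, where `h x k - 1` changes
sign. -/
theorem lambertSeries_one_le {h x : ℝ} (hh : 0 < h) (hx : 0 < x) :
    lambertSeries h 1 x ≤ h * x * lambertSeries h 2 x := by
  have ht : 0 < h * x := mul_pos hh hx
  have hy0 : 0 < exp (-(h * x)) := exp_pos _
  have hy1 : exp (-(h * x)) < 1 := exp_neg_mul_lt_one hh hx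
  have hy2 : 1 - h * x ≤ exp (-(h * x)) := by linarith [add_one_le_exp (-(h * x))]
  set κ := 1 / (h * x) with hκ
  have hκ0 : 0 < κ := one_div_pos.2 ht
  have hκ1 : h * x * κ = 1 := mul_one_div_cancel ht.ne'
  have hL := ((hasSum_lambertSeries hh hx 2).mul_left (h * x)).sub (hasSum_lambertSeries hh hx 1)
  set y := exp (-(h * x)) with hy
  have hR := (((hasSum_nat_mul_pow hy0.le hy1).mul_left (h * x)).sub
    ((hasSum_geometric_of_lt_one hy0.le hy1).sub (hasSum_ite_eq (0 : ℕ) (1 : ℝ)))).mul_left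
      (κ * lambertWeight h κ)
  have hle := hasSum_le (fun k : ℕ => ?_) hR hL
  · have h1 : 0 ≤ κ * lambertWeight h κ * (h * x * (y / (1 - y) ^ 2) - ((1 - y)⁻¹ - 1)) := by
      refine mul_nonneg (mul_nonneg hκ0.le (lambertWeight_pos hh hκ0).le) ?_
      have hne : 0 < 1 - y := sub_pos.2 hy1
      have h2 : h * x * (y / (1 - y) ^ 2) - ((1 - y)⁻¹ - 1)
          = y * (h * x - (1 - y)) / (1 - y) ^ 2 := by
        have := hne.ne'
        field_simp
        ring
      rw [h2]
      exact div_nonneg (mul_nonneg hy0.le (by linarith)) (by positivity)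
    linarith
  · rcases k.eq_zero_or_pos with rfl | hk
    · simp
    · have hk' : (0 : ℝ) < k := by exact_mod_cast hk
      have h3 : 0 ≤ (h * x * k - 1) * (k * lambertWeight h k - κ * lambertWeight h κ) := by
        have e : h * x * k - 1 = h * x * (k - κ) := by rw [mul_sub, hκ1]
        rw [e]
        rcases le_total (k : ℝ) κ with hle | hle
        · exact mul_nonneg_of_nonpos_of_nonpos
            (mul_nonpos_of_nonneg_of_nonpos ht.le (sub_nonpos.2 hle))
            (sub_nonpos.2 (mul_lambertWeight_mono hh hk' hle))
        · exact mul_nonneg (mul_nonneg ht.le (sub_nonneg.2 hle))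
            (sub_nonneg.2 (mul_lambertWeight_mono hh hκ0 hle))
      have h4 := mul_nonneg (pow_pos hy0 k).le h3
      rw [if_neg hk.ne']
      nlinarith

/-- `S₀ S₂ - S₁² ≤ S₂ (S₀ - 2 S₁ + S₂)` since the difference is `(S₁ - S₂)²`, and
`S₀ - 2 S₁ + S₂ = ∑ (k - 1)² y ^ k / (1 - q ^ k)` starts with the term `k = 2`. -/
theorem lambertSeries_zero_mul_two_sub_le {h x : ℝ} (hh : 0 < h) (hx : 1 ≤ x) :
    lambertSeries h 0 x * lambertSeries h 2 x - lambertSeries h 1 x ^ 2 ≤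
      lambertSeries h 2 x * (exp (-h) ^ 2 / (1 - exp (-h)) ^ 4) := by
  have hx0 : 0 < x := one_pos.trans_le hx
  have hS := ((hasSum_lambertSeries hh hx0 0).sub ((hasSum_lambertSeries hh hx0 1).mul_left 2)).add
    (hasSum_lambertSeries hh hx0 2)
  set q := exp (-h) with hq
  set y := exp (-(h * x)) with hy
  have hq0 : 0 < q := exp_pos _
  have hq1 : q < 1 := Real.exp_lt_one_iff.2 (by linarith)
  have hy0 : 0 < y := exp_pos _
  have hyq : y ≤ q := exp_le_exp.2 (by nlinarith)
  have hy1 : y < 1 := hyq.trans_lt hq1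
  have hw : lambertWeight h 2 = 1 / (1 - q ^ 2) := by
    rw [lambertWeight, hq, ← Real.exp_nat_mul]
    congr 3
    push_cast
    ring
  rw [← hasSum_nat_add_iff' 1] at hS
  have hR := ((hasSum_nat_sq_mul_pow hy0.le hy1).mul_left y).mul_left (lambertWeight h 2)
  have hle := hasSum_le (fun k : ℕ => ?_) hS hR
  · simp only [Finset.sum_range_one, Nat.cast_zero, lambertWeight_zero] at hle
    have h1 : lambertWeight h 2 * (y * (y * (1 + y) / (1 - y) ^ 3)) ≤ q ^ 2 / (1 - q) ^ 4 := by
      have h2 : 0 < 1 - q := sub_pos.2 hq1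
      have h3 : 0 < 1 - y := sub_pos.2 hy1
      have h4 : q ^ 2 / (1 - q) ^ 4 = 1 / (1 - q ^ 2) * (q * (q * (1 + q) / (1 - q) ^ 3)) := by
        have : 1 - q ^ 2 ≠ 0 := by nlinarith
        have := h2.ne'
        field_simp
        ring
      rw [h4, hw]
      have : 0 < 1 - q ^ 2 := by nlinarith
      gcongr
    have h5 : lambertSeries h 0 x - 2 * lambertSeries h 1 x + lambertSeries h 2 x
        ≤ q ^ 2 / (1 - q) ^ 4 := by linarith
    have h6 := mul_le_mul_of_nonneg_left h5 (lambertSeries_pos hh hx0 2).le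
    nlinarith [sq_nonneg (lambertSeries h 1 x - lambertSeries h 2 x)]
  · have e : ((k + 1 : ℕ) : ℝ) ^ 0 * lambertWeight h (k + 1 : ℕ) * y ^ (k + 1)
        - 2 * (((k + 1 : ℕ) : ℝ) ^ 1 * lambertWeight h (k + 1 : ℕ) * y ^ (k + 1))
        + ((k + 1 : ℕ) : ℝ) ^ 2 * lambertWeight h (k + 1 : ℕ) * y ^ (k + 1)
        = lambertWeight h (k + 1 : ℕ) * (y * ((k : ℝ) ^ 2 * y ^ k)) := by
      push_cast
      ring
    rw [e]
    rcases k.eq_zero_or_pos with rfl | hk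
    · simp
    · refine mul_le_mul_of_nonneg_right (lambertWeight_anti hh two_pos ?_) (by positivity)
      exact_mod_cast Nat.succ_le_succ hk

theorem sq_mul_exp_neg_le {h : ℝ} (hh : 0 ≤ h) : h ^ 2 * exp (-h) ≤ (1 - exp (-h)) ^ 2 := by
  have h1 : h / 2 ≤ sinh (h / 2) := Real.self_le_sinh_iff.2 (by linarith)
  rw [Real.sinh_eq] at h1
  have h2 : exp (-(h / 2)) * exp (-(h / 2)) = exp (-h) := by rw [← Real.exp_add]; ring_nf
  have h3 : exp (h / 2) * exp (-(h / 2)) = 1 := by rw [← Real.exp_add]; simp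
  have h4 := mul_le_mul_of_nonneg_right (show h ≤ exp (h / 2) - exp (-(h / 2)) by linarith)
    (exp_pos (-(h / 2))).le
  rw [sub_mul, h2, h3] at h4
  calc h ^ 2 * exp (-h) = (h * exp (-(h / 2))) ^ 2 := by rw [← h2]; ring
    _ ≤ (1 - exp (-h)) ^ 2 := pow_le_pow_left₀ (mul_nonneg hh (exp_pos _).le) h4 2

/-- Termwise from `u / (1 - exp (-u)) ≤ 1 + u` with `u = h k`. -/
theorem sq_mul_lambertSeries_one_le_two {h x : ℝ} (hh : 0 < h) (hx : 1 ≤ x) :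
    h ^ 2 * lambertSeries h 1 x ≤ 2 := by
  have hx0 : 0 < x := one_pos.trans_le hx
  have hL := (hasSum_lambertSeries hh hx0 1).mul_left h
  set q := exp (-h) with hq
  set y := exp (-(h * x)) with hy
  have hq0 : 0 < q := exp_pos _
  have hq1 : q < 1 := Real.exp_lt_one_iff.2 (by linarith)
  have hy0 : 0 < y := exp_pos _
  have hyq : y ≤ q := exp_le_exp.2 (by nlinarith)
  have hy1 : y < 1 := hyq.trans_lt hq1
  have hR := ((hasSum_geometric_of_lt_one hy0.le hy1).sub (hasSum_ite_eq (0 : ℕ) (1 : ℝ))).add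
    ((hasSum_nat_mul_pow hy0.le hy1).mul_left h)
  have hle := hasSum_le (fun k : ℕ => ?_) hL hR
  · have h2 : 0 < 1 - q := sub_pos.2 hq1
    have h3 : 0 < 1 - y := sub_pos.2 hy1
    have e : (1 - y)⁻¹ - 1 = y / (1 - y) := by
      have := h3.ne'
      field_simp
      ring
    rw [e] at hle
    have h4 : y / (1 - y) ≤ q / (1 - q) := by gcongr
    have h5 : y / (1 - y) ^ 2 ≤ q / (1 - q) ^ 2 := by gcongr
    have h6 : h * (q / (1 - q)) ≤ 1 := by
      rw [← mul_div_assoc, div_le_one h2]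
      have h7 := add_one_le_exp h
      have h8 : exp h * q = 1 := by rw [hq, ← Real.exp_add]; simp
      nlinarith
    have h9 : h ^ 2 * (q / (1 - q) ^ 2) ≤ 1 := by
      rw [← mul_div_assoc, div_le_one (by positivity)]
      exact sq_mul_exp_neg_le hh.le
    have h10 := mul_le_mul_of_nonneg_left hle hh.le
    have h11 := mul_le_mul_of_nonneg_left h4 hh.le
    have h12 := mul_le_mul_of_nonneg_left h5 (sq_nonneg h)
    nlinarith
  · rcases k.eq_zero_or_pos with rfl | hk
    · simp
    · have hk' : (0 : ℝ) < k := by exact_mod_cast hk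
      have h1 : h * (k * lambertWeight h k) ≤ 1 + h * k := by
        have h2 : 0 < 1 - exp (-(h * k)) := sub_pos.2 (exp_neg_mul_lt_one hh hk')
        have h3 := add_one_le_exp (h * k)
        have h4 : exp (h * k) * exp (-(h * k)) = 1 := by rw [← Real.exp_add]; simp
        rw [lambertWeight, mul_one_div, ← mul_div_assoc, div_le_iff₀ h2]
        nlinarith [exp_pos (-(h * k))]
      rw [if_neg hk.ne']
      have h5 := mul_le_mul_of_nonneg_right h1 (pow_pos hy0 k).le
      nlinarith

/-- Exponential decay at infinity: each term with `k ≥ 1` decays at least as fast as the term `k = 1`. -/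
theorem lambertSeries_le_exp_mul {h x : ℝ} (hh : 0 < h) (hx : 1 ≤ x) (j : ℕ) :
    lambertSeries h j x ≤ exp (-(h * (x - 1))) * lambertSeries h j 1 := by
  refine hasSum_le (fun k : ℕ => ?_) (hasSum_lambertSeries hh (one_pos.trans_le hx) j)
    ((hasSum_lambertSeries hh one_pos j).mul_left _)
  rcases k.eq_zero_or_pos with rfl | hk
  · simp [lambertWeight_zero]
  · have h1 : exp (-(h * x)) ^ k ≤ exp (-(h * (x - 1))) * exp (-(h * 1)) ^ k := by
      rw [← Real.exp_nat_mul, ← Real.exp_nat_mul, ← Real.exp_add]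
      refine exp_le_exp.2 ?_
      have hk' : (1 : ℝ) ≤ k := by exact_mod_cast hk
      nlinarith [mul_nonneg (mul_nonneg hh.le (sub_nonneg.2 hx)) (sub_nonneg.2 hk')]
    calc (k : ℝ) ^ j * lambertWeight h k * exp (-(h * x)) ^ k
        ≤ (k : ℝ) ^ j * lambertWeight h k * (exp (-(h * (x - 1))) * exp (-(h * 1)) ^ k) :=
          mul_le_mul_of_nonneg_left h1
            (mul_nonneg (by positivity) (lambertWeight_nat_nonneg hh k))
      _ = _ := by ring

/-- Expanding `-log (1 - q ^ (n + x))` in powers of `q ^ (n + x)` and summing over `n` first. -/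
theorem hasSum_neg_log_one_sub {h x : ℝ} (hh : 0 < h) (hx : 0 < x) :
    HasSum (fun n : ℕ => -log (1 - exp (-(h * (n + x))))) (lambertLog h x) := by
  have hG : ∀ k : ℕ, HasSum (fun n : ℕ => (k : ℝ)⁻¹ * exp (-(h * (n + x))) ^ k)
      ((k : ℝ)⁻¹ * lambertWeight h k * exp (-(h * x)) ^ k) := fun k => by
    rcases k.eq_zero_or_pos with rfl | hk
    · simp [lambertWeight_zero]
    · have hk' : (0 : ℝ) < k := by exact_mod_cast hk
      have h1 := (hasSum_geometric_of_lt_one (exp_pos (-(h * k))).le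
        (exp_neg_mul_lt_one hh hk')).mul_left ((k : ℝ)⁻¹ * exp (-(h * x)) ^ k)
      convert! h1 using 1
      · ext n
        rw [mul_assoc]
        congr 1
        rw [← Real.exp_nat_mul, ← Real.exp_nat_mul, ← Real.exp_nat_mul, ← Real.exp_add]
        congr 1
        ring
      · rw [lambertWeight]
        ring
  have hsum : Summable fun p : ℕ × ℕ => (p.1 : ℝ)⁻¹ * exp (-(h * (p.2 + x))) ^ p.1 := by
    rw [summable_prod_of_nonneg fun p => by simp only [Pi.zero_apply]; positivity]
    refine ⟨fun k => (hG k).summable, ?_⟩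
    simp_rw [fun k : ℕ => (hG k).tsum_eq]
    exact summable_mul_pow_of_le_pow (abs_inv_mul_lambertWeight_le hh) (exp_pos _).le
      (exp_neg_mul_lt_one hh hx)
  have h1 := hsum.hasSum
  have h2 := h1.prod_fiberwise hG
  have h3 : ∑' p : ℕ × ℕ, (p.1 : ℝ)⁻¹ * exp (-(h * (p.2 + x))) ^ p.1 = lambertLog h x :=
    h2.tsum_eq.symm
  rw [h3, ← (Equiv.prodComm ℕ ℕ).hasSum_iff] at h1
  refine h1.prod_fiberwise fun n => ?_
  have hn : (0 : ℝ) < n + x := by positivity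
  have h4 := hasSum_pow_div_log_of_abs_lt_one (x := exp (-(h * (n + x))))
    (by rw [abs_of_pos (exp_pos _)]; exact exp_neg_mul_lt_one hh hn)
  rw [← hasSum_nat_add_iff' 1]
  convert! h4 using 1
  · ext k
    simp [div_eq_inv_mul]
  · simp

/-! ### The `q`-gamma functions for `q ≠ 1` -/

/-- The series over `n` of `hasSum_neg_log_one_sub` at `x = 2` is the one at `x = 1` without its first
term. This encodes `Γ_q(2) = Γ_q(1)`. -/
theorem lambertLog_two {h : ℝ} (hh : 0 < h) :
    lambertLog h 2 = lambertLog h 1 + log (1 - exp (-h)) := by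
  have h1 := hasSum_neg_log_one_sub hh one_pos
  rw [← hasSum_nat_add_iff' 1] at h1
  have h2 := hasSum_neg_log_one_sub hh two_pos
  have e : (fun n : ℕ => -log (1 - exp (-(h * (n + 2)))))
      = fun n : ℕ => -log (1 - exp (-(h * ((n + 1 : ℕ) + 1)))) := by
    ext n
    push_cast
    ring_nf
  rw [e] at h2
  have h3 := h2.unique h1
  simpa using h3

theorem tprod_one_sub_exp_div {h x : ℝ} (hh : 0 < h) (hx : 0 < x) :
    ∏' n : ℕ, (1 - exp (-(h * (n + 1)))) / (1 - exp (-(h * (n + x))))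
      = exp (lambertLog h x - lambertLog h 1) := by
  have hpos : ∀ {z : ℝ}, 0 < z → ∀ n : ℕ, 0 < 1 - exp (-(h * (n + z))) := fun hz n =>
    sub_pos.2 (exp_neg_mul_lt_one hh (by positivity))
  have h1 := (hasSum_neg_log_one_sub hh hx).sub (hasSum_neg_log_one_sub hh one_pos)
  have e : (fun n : ℕ => -log (1 - exp (-(h * (n + x)))) - -log (1 - exp (-(h * (n + 1)))))
      = fun n : ℕ => log ((1 - exp (-(h * (n + 1)))) / (1 - exp (-(h * (n + x))))) := by
    ext n
    rw [log_div (hpos one_pos n).ne' (hpos hx n).ne']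
    ring
  rw [e] at h1
  rw [← rexp_tsum_eq_tprod (fun n => div_pos (hpos one_pos n) (hpos hx n)) h1.summable,
    h1.tsum_eq]

theorem logGammaModel_of_lt_one {q : ℝ} (hq0 : 0 < q) (hq1 : q < 1) :
    LogGammaModel q (fun x => (1 - x) * log (1 - q) + (lambertLog (-log q) x - lambertLog (-log q) 1))
      (fun x => -log (1 - q) - -log q * lambertSeries (-log q) 0 x)
      (fun x => (-log q) ^ 2 * lambertSeries (-log q) 1 x)
      (fun x => -((-log q) ^ 3 * lambertSeries (-log q) 2 x)) := by
  have hh : 0 < -log q := neg_pos.2 (log_neg hq0 hq1)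
  have hpow : ∀ s : ℝ, q ^ s = exp (-(-log q * s)) := fun s => by
    rw [rpow_def_of_pos hq0]
    ring_nf
  have hexp : exp (-(-log q)) = q := by rw [neg_neg, exp_log hq0]
  refine ⟨fun x hx => ?_, fun x hx => ?_, fun x hx => ?_, fun x hx => ?_, fun x hx => ?_,
    fun x hx => ?_, ?_⟩
  · rw [qGamma, if_pos hq1]
    simp_rw [hpow]
    rw [tprod_one_sub_exp_div hh hx, rpow_def_of_pos (sub_pos.2 hq1), ← Real.exp_add]
    ring_nf
  · have h1 := (((hasDerivAt_id x).const_sub 1).mul_const (log (1 - q))).fun_add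
      ((hasDerivAt_lambertLog hh hx).sub_const (lambertLog (-log q) 1))
    convert! h1 using 1
    ring
  · convert! ((hasDerivAt_lambertSeries hh hx 0).const_mul (-log q)).const_sub (-log (1 - q)) using 1
    ring
  · convert! (hasDerivAt_lambertSeries hh hx 1).const_mul ((-log q) ^ 2) using 1
    ring
  · exact mul_pos (pow_pos hh 2) (lambertSeries_pos hh hx 1)
  · exact neg_neg_of_pos (mul_pos (pow_pos hh 3) (lambertSeries_pos hh hx 2))
  · simp only [lambertLog_two hh, hexp]
    ring

theorem logGammaModel_of_one_lt {q : ℝ} (hq1 : 1 < q) :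
    LogGammaModel q (fun x => (1 - x) * log (q - 1) + log q * (x * (x - 1) / 2) +
        (lambertLog (log q) x - lambertLog (log q) 1))
      (fun x => log q * (x - 1 / 2) - log (q - 1) - log q * lambertSeries (log q) 0 x)
      (fun x => log q + log q ^ 2 * lambertSeries (log q) 1 x)
      (fun x => -(log q ^ 3 * lambertSeries (log q) 2 x)) := by
  have hq0 : 0 < q := one_pos.trans hq1
  have hh : 0 < log q := log_pos hq1
  have hpow : ∀ s : ℝ, q ^ s = exp (log q * s) := fun s => rpow_def_of_pos hq0 s
  refine ⟨fun x hx => ?_, fun x hx => ?_, fun x hx => ?_, fun x hx => ?_, fun x hx => ?_,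
    fun x hx => ?_, ?_⟩
  · rw [qGamma, if_neg hq1.not_gt, if_neg hq1.ne']
    simp_rw [hpow, mul_neg]
    rw [tprod_one_sub_exp_div hh hx, rpow_def_of_pos (sub_pos.2 hq1), ← Real.exp_add,
      ← Real.exp_add]
    ring_nf
  · have h0 : HasDerivAt (fun x : ℝ => x * (x - 1) / 2) (x - 1 / 2) x := by
      convert! ((hasDerivAt_id x).fun_mul ((hasDerivAt_id x).sub_const 1)).div_const 2 using 1
      simp only [id]
      ring
    have h1 := ((((hasDerivAt_id x).const_sub 1).mul_const (log (q - 1))).fun_add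
      (h0.const_mul (log q))).fun_add
      ((hasDerivAt_lambertLog hh hx).sub_const (lambertLog (log q) 1))
    convert! h1 using 1
    ring
  · convert! ((((hasDerivAt_id x).sub_const (1 / 2)).const_mul (log q)).sub_const
      (log (q - 1))).fun_sub ((hasDerivAt_lambertSeries hh hx 0).const_mul (log q)) using 1
    ring
  · convert! ((hasDerivAt_lambertSeries hh hx 1).const_mul (log q ^ 2)).const_add (log q) using 1
    ring
  · exact add_pos hh (mul_pos (pow_pos hh 2) (lambertSeries_pos hh hx 1))
  · exact neg_neg_of_pos (mul_pos (pow_pos hh 3) (lambertSeries_pos hh hx 2))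
  · have h1 : log (1 - exp (-log q)) = log (q - 1) - log q := by
      rw [← log_div (sub_pos.2 hq1).ne' hq0.ne', Real.exp_neg, exp_log hq0, sub_div,
        div_self hq0.ne', one_div]
    simp only [lambertLog_two hh, h1]
    ring

/-! ### Euler's gamma function -/

/-- The coefficient of `x` in the `n`-th term of the series for `log Γ(x)`. The convention
`log 0 = log (-1) = 0` makes it vanish for `n = 0` and `n = 1`. -/
noncomputable def logStep (n : ℕ) : ℝ := log n - log ((n : ℝ) - 1)

/-- The series `∑ (x logStep n + log n - log (x + n))` has the sequence of Euler's limit formula for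
`log Γ(x)` as its partial sums. -/
theorem sum_range_logGammaTerm (x : ℝ) (N : ℕ) :
    ∑ n ∈ Finset.range (N + 1), (x * logStep n + log n - log (x + n)) =
      BohrMollerup.logGammaSeq x N := by
  have h1 : ∑ n ∈ Finset.range (N + 1), logStep n = log N := by
    induction N with
    | zero => simp [logStep]
    | succ N ih =>
      rw [Finset.sum_range_succ, ih, logStep]
      push_cast
      ring_nf
  have h2 : ∑ n ∈ Finset.range (N + 1), log (n : ℝ) = log (N.factorial : ℝ) := by
    induction N with
    | zero => simp
    | succ N ih =>
      have h3 : ∑ n ∈ Finset.range (N + 1), logStep n = log N := by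
        rw [Finset.sum_range_succ] at h1
        rw [logStep] at h1
        push_cast at h1
        rw [add_sub_cancel_right] at h1
        linarith
      rw [Finset.sum_range_succ, ih h3, Nat.factorial_succ, Nat.cast_mul,
        log_mul (by positivity) (by positivity)]
      ring
  rw [Finset.sum_sub_distrib, Finset.sum_add_distrib, ← Finset.mul_sum, h1, h2,
    BohrMollerup.logGammaSeq]

theorem one_div_le_logStep {n : ℕ} (hn : 2 ≤ n) : 1 / (n : ℝ) ≤ logStep n := by
  have hn' : (2 : ℝ) ≤ n := by exact_mod_cast hn
  have h1 : (0 : ℝ) < n - 1 := by linarith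
  have h2 := one_sub_inv_le_log_of_pos (show 0 < (n : ℝ) / (n - 1) by positivity)
  rw [log_div (by positivity) h1.ne', inv_div] at h2
  refine le_trans (le_of_eq ?_) h2
  field_simp
  ring

theorem logStep_le_one_div {n : ℕ} (hn : 2 ≤ n) : logStep n ≤ 1 / ((n : ℝ) - 1) := by
  have hn' : (2 : ℝ) ≤ n := by exact_mod_cast hn
  have h1 : (0 : ℝ) < n - 1 := by linarith
  have h2 := log_le_sub_one_of_pos (show 0 < (n : ℝ) / (n - 1) by positivity)
  rw [log_div (by positivity) h1.ne'] at h2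
  refine le_trans h2 (le_of_eq ?_)
  field_simp
  ring

/-- At `x = 1` the terms are the differences `logStep n - logStep (n + 1)`, non-negative from `n = 2`
on. -/
theorem summable_logGammaTerm_one :
    Summable fun n : ℕ => 1 * logStep n + log n - log (1 + (n : ℝ)) := by
  have e : ∀ n : ℕ, 1 * logStep n + log n - log (1 + (n : ℝ)) = logStep n - logStep (n + 1) := by
    intro n
    simp only [logStep]
    push_cast
    ring_nf
  simp_rw [e]
  rw [← summable_nat_add_iff 2]
  refine summable_of_sum_range_le (c := logStep 2) (fun n => ?_) fun N => ?_
  · have h1 := one_div_le_logStep (show 2 ≤ n + 2 by omega)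
    have h2 := logStep_le_one_div (show 2 ≤ n + 2 + 1 by omega)
    push_cast at h1 h2
    rw [add_sub_cancel_right] at h2
    linarith
  · rw [Finset.sum_congr rfl fun n _ => by rw [add_right_comm],
      Finset.sum_range_sub' (fun n => logStep (n + 2))]
    have h1 := one_div_le_logStep (show 2 ≤ N + 2 by omega)
    have h2 : (0 : ℝ) ≤ 1 / ((N + 2 : ℕ) : ℝ) := by positivity
    simp only [zero_add]
    linarith

/-- A summable bound, uniform for `x` in a bounded interval away from `0`. The summand `1 / δ` is needed
only for `n = 0`. -/
theorem abs_logStep_sub_le {δ B x : ℝ} (hδ : 0 < δ) (hx : x ∈ Ioo δ B) (n : ℕ) :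
    |logStep n - 1 / (x + n)| ≤ (1 / δ + 6 * (B + 1)) * (1 / |(n : ℝ) + 1| ^ (2 : ℝ)) := by
  have hx0 : 0 < x := hδ.trans hx.1
  have hB : 0 < B := hx0.trans hx.2
  have e : |(n : ℝ) + 1| ^ (2 : ℝ) = ((n : ℝ) + 1) ^ 2 := by
    rw [abs_of_nonneg (by positivity)]
    norm_cast
  have hd : 0 < 1 / δ := by positivity
  rw [e]
  rcases Nat.lt_or_ge n 2 with hn | hn
  · interval_cases n
    · have h1 : 1 / x ≤ 1 / δ := one_div_le_one_div_of_le hδ hx.1.le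
      have h2 : |logStep 0 - 1 / (x + (0 : ℕ))| = 1 / x := by
        simp [logStep, abs_of_pos hx0]
      rw [h2]
      norm_num at h1 ⊢
      linarith
    · have h1 : 1 / (x + 1) ≤ 1 := (div_le_one (by linarith)).2 (by linarith)
      have h2 : |logStep 1 - 1 / (x + (1 : ℕ))| = 1 / (x + 1) := by
        have : (0 : ℝ) < x + 1 := by linarith
        simp [logStep, abs_of_pos this]
      rw [h2]
      have h3 : 0 < δ⁻¹ := inv_pos.2 hδ
      norm_num at h1 ⊢
      linarith
  · have hn' : (2 : ℝ) ≤ n := by exact_mod_cast hn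
    have h1 := one_div_le_logStep hn
    have h2 := logStep_le_one_div hn
    have h3 : 1 / (x + n) ≤ 1 / (n : ℝ) := one_div_le_one_div_of_le (by linarith) (by linarith)
    have h4 : 1 / (B + n) ≤ 1 / (x + n) :=
      one_div_le_one_div_of_le (by linarith) (by linarith [hx.2])
    rw [abs_of_nonneg (by linarith)]
    have h5 : 1 / ((n : ℝ) - 1) - 1 / (B + n) ≤ 6 * (B + 1) * (1 / ((n : ℝ) + 1) ^ 2) := by
      have p1 : (0 : ℝ) < n - 1 := by linarith
      have p2 : 0 < B + n := by linarith
      rw [div_sub_div _ _ p1.ne' p2.ne', mul_one_div, div_le_div_iff₀ (by positivity)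
        (by positivity)]
      have p3 : ((n : ℝ) + 1) ^ 2 ≤ 6 * ((n - 1) * (B + n)) := by nlinarith
      nlinarith [mul_le_mul_of_nonneg_left p3 (show (0 : ℝ) ≤ B + 1 by linarith)]
    have h6 : 0 ≤ 1 / δ * (1 / ((n : ℝ) + 1) ^ 2) := by positivity
    rw [add_mul]
    linarith

theorem hasDerivAt_logGammaTerm {x : ℝ} (hx : 0 < x) (n : ℕ) :
    HasDerivAt (fun x : ℝ => x * logStep n + log n - log (x + n)) (logStep n - 1 / (x + n)) x := by
  have h1 := ((hasDerivAt_id x).add_const (n : ℝ)).log (by simp only [id]; positivity)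
  have h2 := (((hasDerivAt_id x).mul_const (logStep n)).add_const (log (n : ℝ))).fun_sub h1
  convert! h2 using 1
  simp

theorem summable_one_div_add_nat_pow {x : ℝ} (hx : 0 < x) {r : ℕ} (hr : 1 < r) :
    Summable fun n : ℕ => 1 / (x + n) ^ r := by
  refine ((summable_one_div_nat_add_rpow x r).2 (by exact_mod_cast hr)).congr fun n => ?_
  rw [abs_of_nonneg (by positivity), rpow_natCast, add_comm]

theorem hasDerivAt_log_Gamma {x : ℝ} (hx : 0 < x) :
    HasDerivAt (fun x => log (Gamma x)) (∑' n : ℕ, (logStep n - 1 / (x + n))) x := by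
  set δ := min x 1 / 2 with hδ
  have hδ0 : 0 < δ := half_pos (lt_min hx one_pos)
  have hδm : δ < min x 1 := half_lt_self (lt_min hx one_pos)
  have hxm : x ∈ Ioo δ (x + 1) := ⟨hδm.trans_le (min_le_left _ _), by linarith⟩
  have h1m : (1 : ℝ) ∈ Ioo δ (x + 1) := ⟨hδm.trans_le (min_le_right _ _), by linarith⟩
  have hu : Summable fun n : ℕ => (1 / δ + 6 * (x + 1 + 1)) * (1 / |(n : ℝ) + 1| ^ (2 : ℝ)) :=
    ((summable_one_div_nat_add_rpow 1 2).2 one_lt_two).mul_left _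
  have hd : ∀ (n : ℕ), ∀ y ∈ Ioo δ (x + 1),
      HasDerivAt (fun x : ℝ => x * logStep n + log n - log (x + n)) (logStep n - 1 / (y + n)) y :=
    fun n y hy => hasDerivAt_logGammaTerm (hδ0.trans hy.1) n
  have hb : ∀ (n : ℕ), ∀ y ∈ Ioo δ (x + 1), ‖logStep n - 1 / (y + n)‖ ≤
      (1 / δ + 6 * (x + 1 + 1)) * (1 / |(n : ℝ) + 1| ^ (2 : ℝ)) :=
    fun n y hy => abs_logStep_sub_le hδ0 hy n
  have hs : ∀ y ∈ Ioo δ (x + 1), Summable fun n : ℕ => y * logStep n + log n - log (y + n) :=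
    fun y hy => summable_of_summable_hasDerivAt_of_isPreconnected
      (g := fun (n : ℕ) (x : ℝ) => x * logStep n + log n - log (x + n)) hu isOpen_Ioo
      isPreconnected_Ioo hd hb h1m summable_logGammaTerm_one hy
  have hD := hasDerivAt_tsum_of_isPreconnected
    (g := fun (n : ℕ) (x : ℝ) => x * logStep n + log n - log (x + n)) hu isOpen_Ioo
    isPreconnected_Ioo hd hb h1m summable_logGammaTerm_one hxm
  refine hD.congr_of_eventuallyEq ?_
  filter_upwards [isOpen_Ioo.mem_nhds hxm] with y hy
  have h1 := (hs y hy).hasSum.tendsto_sum_nat.comp (Filter.tendsto_add_atTop_nat 1)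
  have h2 := BohrMollerup.tendsto_log_gamma (hδ0.trans hy.1)
  refine tendsto_nhds_unique h2 (h1.congr fun N => ?_)
  exact sum_range_logGammaTerm y N

theorem hasDerivAt_tsum_logStep_sub {x : ℝ} (hx : 0 < x) :
    HasDerivAt (fun x => ∑' n : ℕ, (logStep n - 1 / (x + n))) (∑' n : ℕ, 1 / (x + n) ^ 2) x := by
  have hx2 : 0 < x / 2 := half_pos hx
  have hu := summable_one_div_add_nat_pow hx2 one_lt_two
  have hs : Summable fun n : ℕ => logStep n - 1 / (x + n) :=
    Summable.of_norm_bounded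
      (((summable_one_div_nat_add_rpow 1 2).2 one_lt_two).mul_left
        (1 / (x / 2) + 6 * (x + 1 + 1)))
      fun n => abs_logStep_sub_le hx2 ⟨half_lt_self hx, by linarith⟩ n
  refine hasDerivAt_tsum_of_isPreconnected (t := Ioi (x / 2)) (y₀ := x)
    (g := fun (n : ℕ) (x : ℝ) => logStep n - 1 / (x + n))
    (g' := fun (n : ℕ) (x : ℝ) => 1 / (x + n) ^ 2) hu isOpen_Ioi
    isPreconnected_Ioi (fun n y hy => ?_) (fun n y hy => ?_) (mem_Ioi.2 (half_lt_self hx)) hs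
    (mem_Ioi.2 (half_lt_self hx))
  · have hy0 : 0 < y + n := add_pos_of_pos_of_nonneg (hx2.trans hy) n.cast_nonneg
    have h1 := (((hasDerivAt_id y).add_const (n : ℝ)).fun_inv hy0.ne').const_sub (logStep n)
    simpa [neg_div] using h1
  · have hy' : x / 2 < y := hy
    rw [Real.norm_of_nonneg (by positivity)]
    gcongr

theorem hasDerivAt_tsum_one_div_add_sq {x : ℝ} (hx : 0 < x) :
    HasDerivAt (fun x : ℝ => ∑' n : ℕ, 1 / (x + n) ^ 2) (-(2 * ∑' n : ℕ, 1 / (x + n) ^ 3)) x := by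
  have hx2 : 0 < x / 2 := half_pos hx
  have hu := (summable_one_div_add_nat_pow hx2 (show 1 < 3 by norm_num)).mul_left 2
  rw [← neg_mul, ← tsum_mul_left]
  refine hasDerivAt_tsum_of_isPreconnected (t := Ioi (x / 2)) (y₀ := x)
    (g := fun (n : ℕ) (x : ℝ) => 1 / (x + n) ^ 2)
    (g' := fun (n : ℕ) (x : ℝ) => -2 * (1 / (x + n) ^ 3)) hu isOpen_Ioi
    isPreconnected_Ioi (fun n y hy => ?_) (fun n y hy => ?_) (mem_Ioi.2 (half_lt_self hx))
    (summable_one_div_add_nat_pow hx one_lt_two) (mem_Ioi.2 (half_lt_self hx))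
  · have hy0 : 0 < y + n := add_pos_of_pos_of_nonneg (hx2.trans hy) n.cast_nonneg
    have h1 := (((hasDerivAt_id y).add_const (n : ℝ)).fun_pow 2).fun_inv
      (pow_pos hy0 2).ne'
    simp only [one_div]
    convert! h1 using 1
    simp only [id]
    field_simp
    norm_num
  · have hy' : x / 2 < y := hy
    have hy0 : 0 < y := hx2.trans hy
    rw [norm_mul, norm_neg, Real.norm_two, Real.norm_of_nonneg (by positivity)]
    gcongr

theorem tsum_one_div_add_pow_pos {x : ℝ} (hx : 0 < x) {r : ℕ} (hr : 1 < r) :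
    0 < ∑' n : ℕ, 1 / (x + n) ^ r :=
  (summable_one_div_add_nat_pow hx hr).tsum_pos (fun n => by positivity) 0 (by positivity)

theorem logGammaModel_one :
    LogGammaModel 1 (fun x => log (Gamma x)) (fun x => ∑' n : ℕ, (logStep n - 1 / (x + n)))
      (fun x => ∑' n : ℕ, 1 / (x + n) ^ 2) (fun x => -(2 * ∑' n : ℕ, 1 / (x + n) ^ 3)) where
  qGamma_eq x hx := by rw [qGamma, if_neg (lt_irrefl _), if_pos rfl, exp_log (Gamma_pos_of_pos hx)]
  hasDerivAt_log _ hx := hasDerivAt_log_Gamma hx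
  hasDerivAt_psi _ hx := hasDerivAt_tsum_logStep_sub hx
  hasDerivAt_psi' _ hx := hasDerivAt_tsum_one_div_add_sq hx
  psi'_pos _ hx := tsum_one_div_add_pow_pos hx one_lt_two
  psi''_neg _ hx := neg_neg_of_pos (mul_pos two_pos (tsum_one_div_add_pow_pos hx (by norm_num)))
  one_eq_two := by simp

theorem tsum_one_div_add_cube_le {x : ℝ} (hx : 1 ≤ x) :
    ∑' n : ℕ, 1 / (x + n) ^ 3 ≤ ∑' n : ℕ, 1 / (x + n) ^ 2 := by
  have hx0 : 0 < x := one_pos.trans_le hx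
  refine (summable_one_div_add_nat_pow hx0 (by norm_num)).tsum_le_tsum (fun n => ?_)
    (summable_one_div_add_nat_pow hx0 one_lt_two)
  have h1 : 1 ≤ x + n := le_add_of_le_of_nonneg hx n.cast_nonneg
  exact one_div_le_one_div_of_le (by positivity) (pow_le_pow_right₀ h1 (by norm_num))

theorem hasSum_sub_succ_of_antitone {c : ℕ → ℝ} (hc : Antitone c)
    (h0 : Filter.Tendsto c Filter.atTop (nhds 0)) : HasSum (fun n => c n - c (n + 1)) (c 0) := by
  rw [hasSum_iff_tendsto_nat_of_nonneg fun n => sub_nonneg.2 (hc n.le_succ)]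
  simp_rw [Finset.sum_range_sub']
  simpa using h0.const_sub (c 0)

theorem tendsto_inv_add_nat_atTop (x : ℝ) :
    Filter.Tendsto (fun n : ℕ => (x + (n : ℝ))⁻¹) Filter.atTop (nhds 0) :=
  tendsto_inv_atTop_zero.comp
    (Filter.tendsto_atTop_add_const_left _ _ tendsto_natCast_atTop_atTop)

/-- Comparison of `1 / u²` with the telescoping difference of `1 / (u - 1/2)`. -/
theorem tsum_one_div_add_sq_le {x : ℝ} (hx : 1 ≤ x) :
    ∑' n : ℕ, 1 / (x + n) ^ 2 ≤ (x - 1 / 2)⁻¹ := by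
  have hx0 : 0 < x := one_pos.trans_le hx
  have hc : Antitone fun n : ℕ => (x - 1 / 2 + (n : ℝ))⁻¹ := fun m n hmn => by
    have : (m : ℝ) ≤ n := by exact_mod_cast hmn
    refine inv_anti₀ (by linarith [(m.cast_nonneg : (0 : ℝ) ≤ m)]) (by linarith)
  have h1 := hasSum_sub_succ_of_antitone hc (tendsto_inv_add_nat_atTop _)
  have h2 := hasSum_le (fun n : ℕ => ?_) (summable_one_div_add_nat_pow hx0 one_lt_two).hasSum h1
  · simpa using h2
  · have hn : (0 : ℝ) ≤ n := n.cast_nonneg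
    have p1 : 0 < x - 1 / 2 + (n : ℝ) := by linarith
    have p2 : 0 < x - 1 / 2 + ((n : ℝ) + 1) := by linarith
    push_cast
    rw [inv_sub_inv p1.ne' p2.ne']
    rw [div_le_div_iff₀ (by positivity) (by positivity)]
    nlinarith

/-- Comparison of `2 / u³` with the telescoping difference of `1 / u² + 1 / u³`. -/
theorem le_two_mul_tsum_one_div_add_cube {x : ℝ} (hx : 0 < x) :
    x⁻¹ ^ 2 + x⁻¹ ^ 3 ≤ 2 * ∑' n : ℕ, 1 / (x + n) ^ 3 := by
  have hc : Antitone fun n : ℕ => (x + (n : ℝ))⁻¹ ^ 2 + (x + (n : ℝ))⁻¹ ^ 3 := fun m n hmn => by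
    have : (m : ℝ) ≤ n := by exact_mod_cast hmn
    dsimp only
    gcongr
  have ht := ((tendsto_inv_add_nat_atTop x).pow 2).add ((tendsto_inv_add_nat_atTop x).pow 3)
  norm_num at ht
  have h1 := hasSum_sub_succ_of_antitone hc (by simpa using ht)
  have h2 := hasSum_le (fun n : ℕ => ?_) h1
    ((summable_one_div_add_nat_pow hx (show 1 < 3 by norm_num)).hasSum.mul_left 2)
  · simpa using h2
  · have hu : 0 < x + n := by positivity
    push_cast
    rw [← add_assoc]
    set u := x + (n : ℝ)
    have h3 : (2 * (1 / u ^ 3)) - (u⁻¹ ^ 2 + u⁻¹ ^ 3 - ((u + 1)⁻¹ ^ 2 + (u + 1)⁻¹ ^ 3))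
        = (2 * u + 1) / (u ^ 3 * (u + 1) ^ 3) := by
      field_simp
      ring
    have h4 : 0 ≤ (2 * u + 1) / (u ^ 3 * (u + 1) ^ 3) := by positivity
    linarith

/-- `x ψ'(x)` has non-positive derivative on `[1, ∞)`. -/
theorem tsum_sq_le_mul_tsum_cube {x : ℝ} (hx : 1 ≤ x) :
    ∑' n : ℕ, 1 / (x + n) ^ 2 ≤ x * (2 * ∑' n : ℕ, 1 / (x + n) ^ 3) := by
  have hx0 : 0 < x := one_pos.trans_le hx
  refine (tsum_one_div_add_sq_le hx).trans (le_trans ?_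
    (mul_le_mul_of_nonneg_left (le_two_mul_tsum_one_div_add_cube hx0) hx0.le))
  have h1 : 0 < x - 1 / 2 := by linarith
  have h2 : x * (x⁻¹ ^ 2 + x⁻¹ ^ 3) = (x + 1) / x ^ 2 := by field_simp
  rw [h2, inv_eq_one_div, div_le_div_iff₀ h1 (by positivity)]
  nlinarith

/-! ### The critical base -/

/-- Cardano's formula: with `∛(25 - 3√69) ∛(25 + 3√69) = ∛4`, the number `w = 3 q₀ - 2` solves
`w³ = 3 w + 25`. -/
theorem criticalBase_cubic : criticalBase * (criticalBase - 1) ^ 2 = 1 ∧ 1 < criticalBase := by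
  have hs : √69 ^ 2 = 69 := sq_sqrt (by norm_num)
  have hs0 : 0 ≤ √69 := sqrt_nonneg _
  have hs1 : 3 * √69 < 25 := by nlinarith
  have hcube : ∀ t : ℝ, 0 ≤ t → (t ^ (1 / 3 : ℝ)) ^ 3 = t := fun t ht => by
    rw [← rpow_natCast, ← rpow_mul ht]
    norm_num
  have hab : (25 - 3 * √69) ^ (1 / 3 : ℝ) * (25 + 3 * √69) ^ (1 / 3 : ℝ)
      = (2 : ℝ) ^ (1 / 3 : ℝ) * (2 : ℝ) ^ (1 / 3 : ℝ) := by
    rw [← mul_rpow (by linarith) (by linarith), ← mul_rpow (by norm_num) (by norm_num)]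
    congr 1
    nlinarith
  have ha := hcube (25 - 3 * √69) (by linarith)
  have hb := hcube (25 + 3 * √69) (by linarith)
  have hc := hcube 2 (by norm_num)
  have ha0 : 0 ≤ (25 - 3 * √69) ^ (1 / 3 : ℝ) := rpow_nonneg (by linarith) _
  have hb0 : 0 ≤ (25 + 3 * √69) ^ (1 / 3 : ℝ) := rpow_nonneg (by linarith) _
  have hc0 : 0 < (2 : ℝ) ^ (1 / 3 : ℝ) := rpow_pos_of_pos two_pos _
  unfold criticalBase
  generalize (25 - 3 * √69) ^ (1 / 3 : ℝ) = a at *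
  generalize (25 + 3 * √69) ^ (1 / 3 : ℝ) = b at *
  generalize (2 : ℝ) ^ (1 / 3 : ℝ) = c at *
  obtain ⟨w, hw⟩ : ∃ w, w = (a + b) / c := ⟨_, rfl⟩
  have hwc : w * c = a + b := by rw [hw, div_mul_cancel₀ _ hc0.ne']
  have hw0 : 0 ≤ w := by rw [hw]; positivity
  have e : 1 / (3 * c) * (2 * c + a + b) = (2 + w) / 3 := by
    rw [add_assoc, ← hwc]
    field_simp
  have hw3 : w ^ 3 = 3 * w + 25 := by
    have h1 : (w * c) ^ 3 = a ^ 3 + b ^ 3 + 3 * (a * b) * (a + b) := by rw [hwc]; ring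
    rw [hab, ha, hb, ← hwc, mul_pow, hc] at h1
    have h2 : 3 * (c * c) * (w * c) = 3 * w * c ^ 3 := by ring
    rw [h2, hc] at h1
    linarith
  rw [e]
  refine ⟨by nlinarith, ?_⟩
  by_contra hcon
  have : w ≤ 1 := by linarith
  nlinarith [pow_le_one₀ hw0 this (n := 3)]

theorem mul_sub_one_sq_lt {a b : ℝ} (ha : 1 ≤ a) (hab : a < b) :
    a * (a - 1) ^ 2 < b * (b - 1) ^ 2 := by
  have h1 : (a - 1) ^ 2 ≤ (b - 1) ^ 2 := pow_le_pow_left₀ (by linarith) (by linarith) 2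
  have h2 : 0 < (b - 1) ^ 2 := pow_pos (by linarith) 2
  nlinarith

theorem abs_criticalBase_sub_lt : |criticalBase - 1.75488| < 0.000005 := by
  obtain ⟨h, h1⟩ := criticalBase_cubic
  rw [abs_lt]
  constructor
  · by_contra hc
    have h2 : criticalBase < 1.754876 := by linarith
    have := mul_sub_one_sq_lt h1.le h2
    norm_num [h] at this
  · by_contra hc
    have h2 : 1.754884 < criticalBase := by linarith
    have := mul_sub_one_sq_lt (by norm_num) h2
    norm_num [h] at this

theorem sqrt_cubic_iff {q : ℝ} (hq : 0 < q) : √q ^ 3 - √q - 1 = 0 ↔ q = criticalBase := by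
  obtain ⟨h0, h1⟩ := criticalBase_cubic
  have hs : √q ^ 2 = q := sq_sqrt hq.le
  have hs0 : 0 < √q := sqrt_pos.2 hq
  have e : √q ^ 3 - √q - 1 = √q * (q - 1) - 1 := by
    rw [← hs]
    simp only [sqrt_sq hs0.le]
    ring
  rw [e]
  constructor
  · intro h
    have h2 : √q * (q - 1) = 1 := by linarith
    have hq1 : 1 < q := by
      by_contra hc
      nlinarith
    have h3 : q * (q - 1) ^ 2 = 1 := by
      calc q * (q - 1) ^ 2 = (√q * (q - 1)) ^ 2 := by rw [mul_pow, hs]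
        _ = 1 := by rw [h2, one_pow]
    rcases lt_trichotomy q criticalBase with hlt | heq | hlt
    · linarith [mul_sub_one_sq_lt hq1.le hlt]
    · exact heq
    · linarith [mul_sub_one_sq_lt h1.le hlt]
  · intro h
    have h2 : (√q * (q - 1)) ^ 2 = 1 := by rw [mul_pow, hs, h, h0]
    have h3 : 0 ≤ √q * (q - 1) := mul_nonneg hs0.le (by linarith)
    have h4 := (pow_eq_one_iff_of_nonneg h3 two_ne_zero).1 h2
    linarith

/-- `log q / 2 + log (q - 1) = log (q (q - 1)²) / 2`, so its sign is that of `q - q₀`. -/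
theorem criticalBase_le_iff {q : ℝ} (hq : 1 < q) :
    criticalBase ≤ q ↔ 0 ≤ log q / 2 + log (q - 1) := by
  obtain ⟨h0, h1⟩ := criticalBase_cubic
  have hq0 : 0 < q := one_pos.trans hq
  have hq1 : 0 < q - 1 := sub_pos.2 hq
  have e : log (q * (q - 1) ^ 2) = log q + 2 * log (q - 1) := by
    rw [log_mul hq0.ne' (pow_pos hq1 2).ne', log_pow]
    norm_num
  have h2 : 0 ≤ log q / 2 + log (q - 1) ↔ 1 ≤ q * (q - 1) ^ 2 := by
    rw [← log_nonneg_iff (mul_pos hq0 (pow_pos hq1 2)), e]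
    constructor <;> intro h <;> linarith
  rw [h2, ← not_lt, ← not_lt, not_iff_not]
  constructor
  · intro h
    have h3 := mul_sub_one_sq_lt hq.le h
    rwa [h0] at h3
  · intro h
    by_contra hc
    rcases (not_lt.1 hc).eq_or_lt with heq | hlt
    · rw [← heq, h0] at h
      exact lt_irrefl _ h
    · linarith [mul_sub_one_sq_lt h1.le hlt]

/-! ### The three ranges of `q` -/

theorem strictAntiOn_elasticity_of_lt_one {q : ℝ} (hq0 : 0 < q) (hq1 : q < 1) {z : ℝ}
    (hz1 : 1 < z) (hz : z < 3 / 2)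
    (h0 : -log (1 - q) - -log q * lambertSeries (-log q) 0 z = 0) :
    StrictAntiOn (qDigammaElasticity q) (Ioo 1 z) ∧
      StrictAntiOn (qDigammaElasticity q) (Ioi z) := by
  have M := logGammaModel_of_lt_one hq0 hq1
  have hh : 0 < -log q := neg_pos.2 (log_neg hq0 hq1)
  have hexp : exp (-(-log q)) = q := by rw [neg_neg, exp_log hq0]
  have hz0 : 0 < z := one_pos.trans hz1
  refine ⟨?_, M.strictAntiOn_elasticity_right hz0 h0 fun x hx => ?_⟩
  · rcases le_total (-log q) 2 with h2 | h2
    · refine M.strictAntiOn_elasticity_left h0 hz fun x hx => ?_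
      have hx0 : 0 < x := one_pos.trans hx
      have hyq : exp (-(-log q * x)) ≤ q := by
        conv_rhs => rw [← hexp]
        exact exp_le_exp.2 (by nlinarith)
      have hy0 := exp_pos (-(-log q * x))
      have hS := lambertSeries_two_le (ρ := 3 / -log q) hh hx0 (by
        -- `h (1 + y) ≤ 3 (1 - y)` for `y ≤ exp (-h)`, `h ≤ 2`, from `exp h ≥ 1 + h + h² / 2`
        have h3 := quadratic_le_exp_of_nonneg hh.le
        have h4 : exp (-log q) * q = 1 := by
          conv_lhs => rw [← hexp, ← Real.exp_add]
          simp
        rw [div_mul_eq_mul_div, le_div_iff₀ hh]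
        generalize -log q = h at *
        have h5 : (h + 3) ≤ (3 - h) * exp h := by
          have h6 : (3 - h) * (1 + h + h ^ 2 / 2) ≤ (3 - h) * exp h :=
            mul_le_mul_of_nonneg_left h3 (by linarith)
          nlinarith [mul_nonneg (mul_nonneg hh.le (sub_nonneg.2 h2))
            (show 0 ≤ 1 + h by linarith)]
        have h7 := mul_le_mul_of_nonneg_right h5 hq0.le
        rw [mul_assoc, h4, mul_one] at h7
        nlinarith)
      rw [div_mul_eq_mul_div, le_div_iff₀ hh] at hS
      nlinarith [pow_pos hh 2]
    · refine M.strictAntiOn_elasticity_left_of_ratio h0 (M.strictAntiOn_ratio_left h0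
        fun x hx _ => ?_)
      have hx0 : 0 < x := one_pos.trans hx
      have hC := lambertSeries_zero_mul_two_sub_le hh hx.le
      rw [hexp] at hC
      have hS2 := lambertSeries_pos hh hx0 2
      have hc : q ≤ -log (1 - q) := by linarith [log_le_sub_one_of_pos (sub_pos.2 hq1)]
      -- `h exp (-h) ≤ 2 exp (-2)` and `exp (-2) < 0.136` for `h ≥ 2`
      have hq2 : exp (-2) < 0.136 := by
        have h3 := exp_one_gt_d9
        have h4 : exp (-2) * (exp 1 * exp 1) = 1 := by
          rw [← Real.exp_add, ← Real.exp_add]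
          norm_num
        have h5 := exp_pos (-2)
        by_contra hcon
        nlinarith
      have hqle : q ≤ exp (-2) := by
        conv_lhs => rw [← hexp]
        exact exp_le_exp.2 (by linarith)
      have hhq : -log q * q ≤ 2 * exp (-2) := by
        have h3 := add_one_le_exp (-log q - 2)
        have h4 : exp (-log q - 2) * exp (-(-log q)) = exp (-2) := by
          rw [← Real.exp_add]
          ring_nf
        rw [hexp] at h4
        nlinarith
      have hkey : -log q * (q ^ 2 / (1 - q) ^ 4) < -log (1 - q) := by
        refine lt_of_lt_of_le ?_ hc
        have h3 : 0.864 ^ 4 ≤ (1 - q) ^ 4 := pow_le_pow_left₀ (by norm_num) (by linarith) 4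
        have h4 : (0.5 : ℝ) < (1 - q) ^ 4 := lt_of_lt_of_le (by norm_num) h3
        rw [← mul_div_assoc, div_lt_iff₀ (by linarith)]
        nlinarith
      generalize -log q = h at *
      generalize -log (1 - q) = c at *
      have h6 : h * (lambertSeries h 0 x * lambertSeries h 2 x - lambertSeries h 1 x ^ 2)
          < c * lambertSeries h 2 x := by
        have h7 := mul_le_mul_of_nonneg_left hC hh.le
        have h8 := mul_lt_mul_of_pos_right hkey hS2
        nlinarith
      have h9 := mul_lt_mul_of_pos_left h6 (pow_pos hh 3)
      nlinarith
  · have hx0 : 0 < x := hz0.trans hx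
    have h1 := lambertSeries_one_le hh hx0
    have h2 := M.psi_pos hz0 h0 hx
    have h3 := M.psi'_pos x hx0
    have h4 : (-log q) ^ 2 * lambertSeries (-log q) 1 x
        + x * -((-log q) ^ 3 * lambertSeries (-log q) 2 x) ≤ 0 := by
      nlinarith [mul_le_mul_of_nonneg_left h1 (sq_nonneg (-log q))]
    exact (mul_nonpos_of_nonpos_of_nonneg h4 h2.le).trans_lt (mul_pos hx0 (pow_pos h3 2))

theorem strictAntiOn_ratio_left_one {z : ℝ} (hz : z < 3 / 2)
    (h0 : ∑' n : ℕ, (logStep n - 1 / (z + n)) = 0) :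
    StrictAntiOn (qDigammaRatio 1) (Ioo 1 z) := by
  refine logGammaModel_one.strictAntiOn_ratio_left h0 fun x hx hxz => ?_
  refine logGammaModel_one.mul_lt_sq_of_neg_psi''_le h0 hz hx hxz ?_
  rw [neg_neg]
  exact mul_le_mul_of_nonneg_left (tsum_one_div_add_cube_le hx.le) two_pos.le

theorem strictAntiOn_elasticity_right_one {z : ℝ} (hz1 : 1 < z)
    (h0 : ∑' n : ℕ, (logStep n - 1 / (z + n)) = 0) :
    StrictAntiOn (qDigammaElasticity 1) (Ioi z) := by
  have hz0 : 0 < z := one_pos.trans hz1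
  refine logGammaModel_one.strictAntiOn_elasticity_right hz0 h0 fun x hx => ?_
  have hx1 : 1 < x := hz1.trans hx
  have hx0 : 0 < x := one_pos.trans hx1
  have h1 := tsum_sq_le_mul_tsum_cube hx1.le
  have h2 := logGammaModel_one.psi_pos hz0 h0 hx
  have h3 := logGammaModel_one.psi'_pos x hx0
  exact (mul_nonpos_of_nonpos_of_nonneg (by linarith) h2.le).trans_lt
    (mul_pos hx0 (pow_pos h3 2))

theorem strictAntiOn_ratio_left_of_one_lt {q : ℝ} (hq : 1 < q) {z : ℝ} (hz : z < 3 / 2)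
    (h0 : log q * (z - 1 / 2) - log (q - 1) - log q * lambertSeries (log q) 0 z = 0) :
    StrictAntiOn (qDigammaRatio q) (Ioo 1 z) := by
  have M := logGammaModel_of_one_lt hq
  have hh : 0 < log q := log_pos hq
  refine M.strictAntiOn_ratio_left h0 fun x hx hxz => ?_
  refine M.mul_lt_sq_of_neg_psi''_le h0 hz hx hxz ?_
  have hx0 : 0 < x := one_pos.trans hx
  have h1 := sq_mul_lambertSeries_one_le_two hh hx.le
  have hS := lambertSeries_two_le (ρ := (2 + log q) / log q) hh hx0 (by
    -- `h (1 + y) ≤ (2 + h) (1 - y)` is `y (1 + h) ≤ 1`, which follows from `1 + h ≤ exp h`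
    have h3 : exp (-(log q * x)) ≤ exp (-log q) := exp_le_exp.2 (by nlinarith)
    have h4 := add_one_le_exp (log q)
    have h5 : exp (log q) * exp (-log q) = 1 := by rw [← Real.exp_add]; simp
    have h6 := exp_pos (-log q)
    rw [div_mul_eq_mul_div, le_div_iff₀ hh]
    nlinarith)
  rw [div_mul_eq_mul_div, le_div_iff₀ hh] at hS
  generalize log q = h at *
  have h7 := mul_le_mul_of_nonneg_left hS (sq_nonneg h)
  have h8 := mul_le_mul_of_nonneg_left h1 hh.le
  nlinarith

/-- For `q ≥ q₀` the linear function asymptotic to `ψ_q` at infinity has non-positive constant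
term, so `ψ_q(x) < x log q`, while `ψ_q' > log q` and `ψ_q'' < 0`. -/
theorem strictAntiOn_elasticity_right_of_criticalBase_le {q : ℝ} (hq : 1 < q)
    (hqc : criticalBase ≤ q) {z : ℝ} (hz1 : 1 < z)
    (h0 : log q * (z - 1 / 2) - log (q - 1) - log q * lambertSeries (log q) 0 z = 0) :
    StrictAntiOn (qDigammaElasticity q) (Ioi z) := by
  have M := logGammaModel_of_one_lt hq
  have hh : 0 < log q := log_pos hq
  have hz0 : 0 < z := one_pos.trans hz1
  refine M.strictAntiOn_elasticity_right hz0 h0 fun x hx => ?_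
  have hx0 : 0 < x := hz0.trans hx
  have h1 := (criticalBase_le_iff hq).1 hqc
  have h2 := mul_pos hh (lambertSeries_pos hh hx0 0)
  have h3 := mul_pos (pow_pos hh 2) (lambertSeries_pos hh hx0 1)
  have h4 := M.psi_pos hz0 h0 hx
  have h5 := M.psi'_pos x hx0
  have h6 := M.psi''_neg x hx0
  have h7 : log q * (x - 1 / 2) - log (q - 1) - log q * lambertSeries (log q) 0 x
      < x * log q := by linarith
  generalize log q * (x - 1 / 2) - log (q - 1) - log q * lambertSeries (log q) 0 x = f at *
  have h8 : log q < log q + log q ^ 2 * lambertSeries (log q) 1 x := by linarith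
  generalize log q + log q ^ 2 * lambertSeries (log q) 1 x = f₁ at *
  generalize -(log q ^ 3 * lambertSeries (log q) 2 x) = f₂ at *
  have h9 : f₁ * f < f₁ * (x * f₁) :=
    mul_lt_mul_of_pos_left (h7.trans (mul_lt_mul_of_pos_left h8 hx0)) h5
  have h10 : x * f₂ * f < 0 := mul_neg_of_neg_of_pos (mul_neg_of_pos_of_neg hx0 h6) h4
  nlinarith

/-- For `1 < q < q₀` the linear function asymptotic to `ψ_q` at infinity is `(x + a) log q` with
`a > 0`. The remaining terms decay exponentially, so `φ_q < 1` at some point; a non-increasing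
`φ_q` would then stay below a constant less than `1`, although `φ_q(x) ≥ x / (x + a)`. -/
theorem not_antitoneOn_elasticity_right {q : ℝ} (hq : 1 < q) (hqc : q < criticalBase) {z : ℝ}
    (hz1 : 1 < z)
    (h0 : log q * (z - 1 / 2) - log (q - 1) - log q * lambertSeries (log q) 0 z = 0) :
    ¬ AntitoneOn (qDigammaElasticity q) (Ioi z) := by
  intro hanti
  have M := logGammaModel_of_one_lt hq
  have hh : 0 < log q := log_pos hq
  have hz0 : 0 < z := one_pos.trans hz1
  have h1 : log q / 2 + log (q - 1) < 0 := by
    rw [← not_le, ← criticalBase_le_iff hq]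
    exact hqc.not_ge
  set h := log q with hdef
  set S := lambertSeries h 1 1 with hS
  have hS0 : 0 < S := lambertSeries_pos hh one_pos 1
  obtain ⟨x, hxz, hx⟩ : ∃ x, z < x ∧
      h * S * exp h * (exp (-(h * x)) + h * x * exp (-(h * x)))
        < -(h / 2 + log (q - 1)) := by
    have t1 : Filter.Tendsto (fun x : ℝ => h * x) Filter.atTop Filter.atTop :=
      Filter.tendsto_id.const_mul_atTop hh
    have t2 := (tendsto_pow_mul_exp_neg_atTop_nhds_zero 0).comp t1
    have t3 := (tendsto_pow_mul_exp_neg_atTop_nhds_zero 1).comp t1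
    have t4 := (t2.add t3).const_mul (h * S * exp h)
    rw [add_zero, mul_zero] at t4
    obtain ⟨x, hx1, hx2⟩ := ((t4.eventually (gt_mem_nhds (show (0 : ℝ) < -(h / 2 + log (q - 1))
      by linarith))).and (Filter.eventually_gt_atTop z)).exists
    refine ⟨x, hx2, ?_⟩
    simpa using hx1
  have hx1 : 1 < x := hz1.trans hxz
  have hx0 : 0 < x := one_pos.trans hx1
  have h2 : lambertSeries h 1 x ≤ exp h * exp (-(h * x)) * S := by
    refine (lambertSeries_le_exp_mul hh hx1.le 1).trans (le_of_eq ?_)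
    rw [← Real.exp_add, hS]
    ring_nf
  have h3 := lambertSeries_zero_le_one hh hx0
  have hf := M.psi_pos hz0 h0 hxz
  have hφ : qDigammaElasticity q x < 1 := by
    rw [M.qDigammaElasticity_eq hx0, div_lt_one hf]
    have h4 : h * lambertSeries h 0 x + h * (h * x) * lambertSeries h 1 x
        ≤ h * S * exp h * (exp (-(h * x)) + h * x * exp (-(h * x))) := by
      have h5 := mul_le_mul_of_nonneg_left (h3.trans h2) hh.le
      have h6 := mul_le_mul_of_nonneg_left h2 (mul_pos hh (mul_pos hh hx0)).le
      nlinarith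
    nlinarith
  set φ := qDigammaElasticity q x with hφdef
  obtain ⟨a, ha⟩ : ∃ a, h * a = -(h / 2 + log (q - 1)) :=
    ⟨-(h / 2 + log (q - 1)) / h, mul_div_cancel₀ _ hh.ne'⟩
  have ha0 : 0 < a := by
    by_contra hc
    nlinarith
  -- beyond `w = x + a / (1 - φ)` one has `w / (w + a) > φ`
  set w := x + a / (1 - φ) with hw
  have hd : 0 < a / (1 - φ) := div_pos ha0 (sub_pos.2 hφ)
  have hd1 : a / (1 - φ) * (1 - φ) = a := div_mul_cancel₀ _ (sub_pos.2 hφ).ne'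
  have hxw : x < w := by linarith
  have hw0 : 0 < w := hx0.trans hxw
  have h5 : qDigammaElasticity q w ≤ φ := hanti hxz (mem_Ioi.2 (hxz.trans hxw)) hxw.le
  have hfw := M.psi_pos hz0 h0 (hxz.trans hxw)
  have hφ0 : 0 < φ := by
    rw [hφdef, M.qDigammaElasticity_eq hx0]
    exact div_pos (mul_pos hx0 (M.psi'_pos x hx0)) hf
  rw [M.qDigammaElasticity_eq hw0, div_le_iff₀ hfw] at h5
  have h6 := mul_pos hh (lambertSeries_pos hh hw0 0)
  have h7 := mul_pos (pow_pos hh 2) (lambertSeries_pos hh hw0 1)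
  have h8 : h * (w - 1 / 2) - log (q - 1) - h * lambertSeries h 0 w ≤ h * (w + a) := by
    linarith
  have h9 : w * h ≤ φ * (h * (w + a)) := by
    refine le_trans ?_ (h5.trans (mul_le_mul_of_nonneg_left h8 hφ0.le))
    exact mul_le_mul_of_nonneg_left (by linarith) hw0.le
  have h10 : w ≤ φ * (w + a) := by
    by_contra hc
    nlinarith
  have h11 : w * (1 - φ) = x * (1 - φ) + a := by rw [hw, add_mul, hd1]
  have h12 := mul_pos hx0 (sub_pos.2 hφ)
  nlinarith

end

theorem mainTheorem8 :
    (0 < criticalBase ∧ |criticalBase - 1.75488| < 0.000005 ∧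
      ∀ q : ℝ, 0 < q → ((√q) ^ 3 - √q - 1 = 0 ↔ q = criticalBase)) ∧
    ∀ q : ℝ, 0 < q →
      ∃ xq : ℝ, 1 < xq ∧ xq < 3 / 2 ∧ (∀ x : ℝ, 0 < x → (qDigamma q x = 0 ↔ x = xq)) ∧
        (1 ≤ q →
          StrictAntiOn (qDigammaRatio q) (Ioo 1 xq) ∧
          StrictAntiOn (qDigammaRatio q) (Ioi xq)) ∧
        (1 < q → StrictAntiOn (qDigammaElasticity q) (Ioo 1 xq)) ∧
        (StrictAntiOn (qDigammaElasticity q) (Ioo 1 xq) ∧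
          StrictAntiOn (qDigammaElasticity q) (Ioi xq) ↔
            q ∈ Ioc 0 1 ∪ Ici criticalBase) ∧
        (AntitoneOn (qDigammaElasticity q) (Ioo 1 xq) ∧
          AntitoneOn (qDigammaElasticity q) (Ioi xq) ↔
            q ∈ Ioc 0 1 ∪ Ici criticalBase) := by
  obtain ⟨-, hc1⟩ := criticalBase_cubic
  refine ⟨⟨one_pos.trans hc1, abs_criticalBase_sub_lt, fun q hq => sqrt_cubic_iff hq⟩,
    fun q hq => ?_⟩
  have both : ∀ {z : ℝ}, StrictAntiOn (qDigammaElasticity q) (Ioo 1 z) ∧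
      StrictAntiOn (qDigammaElasticity q) (Ioi z) → q ∈ Ioc 0 1 ∪ Ici criticalBase →
      (StrictAntiOn (qDigammaElasticity q) (Ioo 1 z) ∧
          StrictAntiOn (qDigammaElasticity q) (Ioi z) ↔ q ∈ Ioc 0 1 ∪ Ici criticalBase) ∧
        (AntitoneOn (qDigammaElasticity q) (Ioo 1 z) ∧
          AntitoneOn (qDigammaElasticity q) (Ioi z) ↔ q ∈ Ioc 0 1 ∪ Ici criticalBase) :=
    fun h hm => ⟨iff_of_true h hm, iff_of_true ⟨h.1.antitoneOn, h.2.antitoneOn⟩ hm⟩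
  rcases lt_trichotomy q 1 with hq1 | rfl | hq1
  · have M := logGammaModel_of_lt_one hq hq1
    obtain ⟨z, hz1, hz, h0⟩ := M.exists_zero
    refine ⟨z, hz1, hz, fun x hx => M.qDigamma_eq_zero_iff (one_pos.trans hz1) h0 hx,
      fun h => absurd h hq1.not_ge, fun h => absurd h hq1.not_gt, ?_⟩
    exact both (strictAntiOn_elasticity_of_lt_one hq hq1 hz1 hz h0) (Or.inl ⟨hq, hq1.le⟩)
  · have M := logGammaModel_one
    obtain ⟨z, hz1, hz, h0⟩ := M.exists_zero
    have hz0 : 0 < z := one_pos.trans hz1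
    have hG := strictAntiOn_ratio_left_one hz h0
    refine ⟨z, hz1, hz, fun x hx => M.qDigamma_eq_zero_iff hz0 h0 hx,
      fun _ => ⟨hG, M.strictAntiOn_ratio_right hz0 h0⟩, fun h => absurd h (lt_irrefl _), ?_⟩
    exact both ⟨M.strictAntiOn_elasticity_left_of_ratio h0 hG,
      strictAntiOn_elasticity_right_one hz1 h0⟩ (Or.inl ⟨one_pos, le_rfl⟩)
  · have M := logGammaModel_of_one_lt hq1
    obtain ⟨z, hz1, hz, h0⟩ := M.exists_zero
    have hz0 : 0 < z := one_pos.trans hz1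
    have hG := strictAntiOn_ratio_left_of_one_lt hq1 hz h0
    have hE := M.strictAntiOn_elasticity_left_of_ratio h0 hG
    refine ⟨z, hz1, hz, fun x hx => M.qDigamma_eq_zero_iff hz0 h0 hx,
      fun _ => ⟨hG, M.strictAntiOn_ratio_right hz0 h0⟩, fun _ => hE, ?_⟩
    rcases le_or_gt criticalBase q with hqc | hqc
    · exact both ⟨hE, strictAntiOn_elasticity_right_of_criticalBase_le hq1 hqc hz1 h0⟩
        (Or.inr hqc)
    · have hm : q ∉ Ioc 0 1 ∪ Ici criticalBase := by
        rintro (h | h)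
        · exact hq1.not_ge h.2
        · exact hqc.not_ge h
      have hno := not_antitoneOn_elasticity_right hq1 hqc hz1 h0
      exact ⟨iff_of_false (fun h => hno h.2.antitoneOn) hm, iff_of_false (fun h => hno h.2) hm⟩
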